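/- **Setting.** Let $\mathcal S$ be a finite state space, $P=(\mathcal P(s'|s))$ a stochastic matrix on $\mathcal S$, $\mathcal R(s,s')$ transition rewards with $|\mathcal R(s,s')|\le B$, $0<\gamma<1$ a discount factor and $\phi(s)\in\mathbb R^d$ feature vectors with $\|\phi(s)\|\le 1$ such that the feature matrix $\Phi$ (rows $\phi(s)^\top$) has full column rank. Suppose $\pi(s')=\lim_{t\to\infty}P^t(s,s')>0$ for all $s,s'$, and there are $\bar\kappa>0$, $0<\rho<1$ with $\sum_{s'}|P^t(s,s')-\pi(s')|\le\bar\kappa\rho^t$ for all $s$ and $t\ge 0$. Let $\omega=\lambda_{\min}(\Phi^\top\mathrm{Diag}(\pi)\Phi)$. With $\mathcal R(s)=\sum_{s'}\mathcal P(s'|s)\mathcal R(s,s')$ and $0\le\lambda\le1$, let $$(\mathcal T^\lambda V)(s)=(1-\lambda)\sum_{m=0}^\infty\lambda^m\,\mathbb E\Big[\sum_{t=0}^m\gamma^t\mathcal R(s_t)+\gamma^{m+1}V(s_{m+1})\,\Big|\,s_0=s\Big]\quad(\lambda<1),\qquad (\mathcal T^1V)(s)=\mathbb E\Big[\sum_{t=0}^\infty\gamma^t\mathcal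 R(s_t)\,\Big|\,s_0=s\Big],$$ and let $\theta^*$ be the zero of $\mathbf g^\lambda(\theta)=\Phi^\top\mathrm{Diag}(\pi)(\mathcal T^\lambda\Phi\theta-\Phi\theta)$. **Algorithm AdaTD($\lambda$).** Let $\eta>0$, $\delta>0$, $0\le\beta<1$, and let $\hat R>0$ satisfy $\hat R\ge 2B\big/\big(\sqrt\omega\,(1-\gamma)\sqrt{1-\gamma(1-\lambda)/(1-\gamma\lambda)}\big)$. Let $s_1,s_2,\dots$ be a Markov chain with transition matrix $P$ and arbitrary initial law, $\|\theta^1\|\le\hat R$, $\mathbf z^0=\mathbf m^0=0$, $v^0=0$, and for $k=1,2,\dots$ $$\mathbf z^k=\gamma\lambda\,\mathbf z^{k-1}+\phi(s_k),\qquad \mathbf g^k=\big(\mathcal R(s_k,s_{k+1})+\gamma\phi(s_{k+1})^\top\theta^k-\phi(s_k)^\top\theta^k\big)\mathbf z^k,$$ $$\mathbf m^k=\beta\mathbf m^{k-1}+(1-\beta)\mathbf g^k,\qquad v^k=v^{k-1}+\|\mathbf g^k\|^2,\qquad \theta^{k+1}=\mathrm{Proj}_{\{\|x\|\le\hat R\}}\big(\theta^k+\eta\,\mathbf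 m^k/\sqrt{v^k+\delta}\big).$$ **Proposition.** (i) There are constants $C,\varepsilon_1>0$ and $p\in\mathbb N$, depending only on $\gamma,\lambda,\hat R,\eta,\delta,\beta,B,\bar\kappa,\omega$ (and not on $\rho$, $\epsilon$, $\mathcal S$, $d$ or the rest of the problem), such that for all $0<\epsilon\le\min\{\varepsilon_1,\rho\}$ there is an integer $K\ge1$ with $$\min_{1\le k\le K}\mathbb E\|\theta^*-\theta^k\|^2\le\epsilon\qquad\text{and}\qquad K\le C\,b\,(\ln b)^p,\qquad b=\frac{\ln^4\frac1\epsilon}{\epsilon^2\ln^4\frac1\rho};$$ that is, the number of iterations needed for $\epsilon$-accuracy is $\tilde O\big(\ln^4\frac1\epsilon/(\epsilon^2\ln^4\frac1\rho)\big)$. (ii) Let $c>0$ and $0<\nu\le1$. If in addition, almost surely, $v^k\le c\,k^\nu$ for all $k\ge1$, the same holds, with constants $C,\varepsilon_1,p$ that may depend on $c$ and $\nu$ too, for $$b=\Big(\ln\tfrac1\epsilon\Big)^{\frac{2}{1-\nu/2}}\Big/\Big[\epsilon^{\frac1{1-\nu/2}}\Big(\ln\tfrac1\rho\Big)^{\frac2{1-\nu/2}}\Big].$$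 -/

import Mathlib

open MeasureTheory Filter Topology Matrix

noncomputable section

namespace AdaTD

variable {S : Type*} [Fintype S] [DecidableEq S] {d : ℕ}

/-- The data of policy evaluation with linear function approximation on a finite state space `S`,
once the policy has been fixed: `P s s'` is the probability of moving from `s` to `s'`,
`r s s'` is the reward of that transition, `φ s` is the feature vector of the state `s`. -/
structure Problem (S : Type*) (d : ℕ) where
  P : Matrix S S ℝ
  r : S → S → ℝ
  φ : S → EuclideanSpace ℝ (Fin d)

/-- The expected reward `R(s) = ∑ s', P(s' | s) R(s, s')`. -/
def Problem.meanReward (M : Problem S d) (s : S) : ℝ := ∑ s', M.P s s' * M.r s s'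

/-- The feature matrix `Φ`, whose rows are the feature vectors. -/
def Problem.Phi (M : Problem S d) : Matrix S (Fin d) ℝ := Matrix.of fun s j => M.φ s j

/-- The value function `V(s) = E[∑ t, γ ^ t R(s_t) | s_0 = s]`. -/
def Problem.value (M : Problem S d) (γ : ℝ) (s : S) : ℝ :=
  ∑' t : ℕ, γ ^ t * ((M.P ^ t) *ᵥ M.meanReward) s

/-- The `(m+1)`-step Bellman operator
`V ↦ E[∑ t ≤ m, γ ^ t R(s_t) + γ ^ (m+1) V(s_{m+1}) | s_0 = s]`. -/
def Problem.bellmanStep (M : Problem S d) (γ : ℝ) (m : ℕ) (V : S → ℝ) (s : S) : ℝ :=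
  ∑ t ∈ Finset.range (m + 1), γ ^ t * ((M.P ^ t) *ᵥ M.meanReward) s
    + γ ^ (m + 1) * ((M.P ^ (m + 1)) *ᵥ V) s

/-- The `lam`-averaged Bellman operator `(1 - lam) ∑ m, lam ^ m T^(m)`. For `lam = 1`, where the
series has no meaning, it is the usual limit `lam → 1`: the constant operator `V ↦ value`. -/
def Problem.bellmanLam (M : Problem S d) (γ lam : ℝ) (V : S → ℝ) (s : S) : ℝ :=
  if lam = 1 then M.value γ s
  else (1 - lam) * ∑' m : ℕ, lam ^ m * M.bellmanStep γ m V s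

/-- The limiting update direction `Φᵀ Diag(π) (T^lam Φ θ - Φ θ)`. -/
def Problem.gLam (M : Problem S d) (stat : S → ℝ) (γ lam : ℝ)
    (θ : EuclideanSpace ℝ (Fin d)) : Fin d → ℝ :=
  (M.Phiᵀ * Matrix.diagonal stat) *ᵥ
    (M.bellmanLam γ lam (M.Phi *ᵥ fun j => θ j) - M.Phi *ᵥ fun j => θ j)

/-- Geometric ergodicity: `stat` is the positive limit of the `t`-step transition
probabilities, approached at the speed `κ ρ ^ t` in total variation from every state. -/
structure GeomErgodic (P : Matrix S S ℝ) (stat : S → ℝ) (κ ρ : ℝ) : Prop where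
  tendsto : ∀ s s', Tendsto (fun t : ℕ => (P ^ t) s s') atTop (𝓝 (stat s'))
  pos : ∀ s, 0 < stat s
  bound : ∀ (t : ℕ) (s : S), ∑ s', |(P ^ t) s s' - stat s'| ≤ κ * ρ ^ t

/-- `X 0, X 1, …` is a Markov chain with transition matrix `P`, with any initial law. -/
structure IsMarkovChain {Ω : Type*} [MeasurableSpace Ω] [MeasurableSpace S]
    (μ : Measure Ω) (P : Matrix S S ℝ) (X : ℕ → Ω → S) : Prop where
  measurable : ∀ k, Measurable (X k)
  markov : ∀ (n : ℕ) (x : ℕ → S),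
    μ.real {ω | ∀ i ≤ n + 1, X i ω = x i}
      = μ.real {ω | ∀ i ≤ n, X i ω = x i} * P (x n) (x (n + 1))

/-- The Euclidean projection onto the closed ball of radius `R` about the origin. -/
def projBall (R : ℝ) (y : EuclideanSpace ℝ (Fin d)) : EuclideanSpace ℝ (Fin d) :=
  if ‖y‖ ≤ R then y else (R / ‖y‖) • y

/-- The memory of the algorithm after `k` iterations: `θ^(k+1)`, `z^k`, `m^k`, `v^k`. -/
structure Memory (d : ℕ) where
  theta : EuclideanSpace ℝ (Fin d)
  z : EuclideanSpace ℝ (Fin d)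
  m : EuclideanSpace ℝ (Fin d)
  v : ℝ

/-- The hyperparameters of AdaTD(λ): discount, trace decay, radius of the ball, step size,
numerical stabilizer and momentum. -/
structure Hyper where
  γ : ℝ
  lam : ℝ
  R : ℝ
  η : ℝ
  δ : ℝ
  β : ℝ

/-- The stochastic semi-gradient of TD(λ) at `θ`, for the transition `s → s'` and the
eligibility trace `z`. -/
def Problem.semigrad (M : Problem S d) (γ : ℝ) (θ : EuclideanSpace ℝ (Fin d)) (s s' : S)
    (z : EuclideanSpace ℝ (Fin d)) : EuclideanSpace ℝ (Fin d) :=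
  (M.r s s' + γ * inner ℝ (M.φ s') θ - inner ℝ (M.φ s) θ) • z

/-- One iteration of AdaTD(λ) on the observed transition `s → s'`. -/
def Problem.step (M : Problem S d) (h : Hyper) (s s' : S) (a : Memory d) : Memory d :=
  let z := (h.γ * h.lam) • a.z + M.φ s
  let g := M.semigrad h.γ a.theta s s' z
  let m := h.β • a.m + (1 - h.β) • g
  let v := a.v + ‖g‖ ^ 2
  { theta := projBall h.R (a.theta + (h.η / √(v + h.δ)) • m)
    z := z
    m := m
    v := v }

/-- The memory after `k` iterations, started at the parameter `θ₁`, when the observed states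
are `x 1, x 2, …`; iteration `k` uses the transition `x k → x (k + 1)`. -/
def Problem.run (M : Problem S d) (h : Hyper) (θ₁ : EuclideanSpace ℝ (Fin d)) (x : ℕ → S) :
    ℕ → Memory d
  | 0 => { theta := θ₁, z := 0, m := 0, v := 0 }
  | k + 1 => M.step h (x (k + 1)) (x (k + 2)) (M.run h θ₁ x k)

/-- The iterate `θ^k`, `k ≥ 1` (with `θ^0 = θ^1`, the initial parameter). -/
def Problem.theta (M : Problem S d) (h : Hyper) (θ₁ : EuclideanSpace ℝ (Fin d)) (x : ℕ → S)
    (k : ℕ) : EuclideanSpace ℝ (Fin d) := (M.run h θ₁ x (k - 1)).theta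

/-- The accumulated squared norms `v^k` of the semi-gradients. -/
def Problem.v (M : Problem S d) (h : Hyper) (θ₁ : EuclideanSpace ℝ (Fin d)) (x : ℕ → S)
    (k : ℕ) : ℝ := (M.run h θ₁ x k).v

/-- The standing assumptions on the problem: a stochastic transition matrix, rewards bounded
by `B`, geometric ergodicity with constants `κ`, `ρ`, features of norm at most one and
linearly independent feature columns, and `w` the least eigenvalue of `Φᵀ Diag(π) Φ`. -/
structure Admissible (M : Problem S d) (stat : S → ℝ) (B κ ρ w : ℝ) : Prop where
  stochastic : M.P ∈ Matrix.rowStochastic ℝ S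
  reward : ∀ s s', |M.r s s'| ≤ B
  ergodic : GeomErgodic M.P stat κ ρ
  feature : ∀ s, ‖M.φ s‖ ≤ 1
  rank : LinearIndependent ℝ M.Phi.col
  eigen : IsLeast (spectrum ℝ (M.Phiᵀ * Matrix.diagonal stat * M.Phi)) w

/-- The conditions on the hyperparameters. -/
structure Hyper.Valid (h : Hyper) (B w : ℝ) : Prop where
  γ_pos : 0 < h.γ
  γ_lt : h.γ < 1
  lam_nonneg : 0 ≤ h.lam
  lam_le : h.lam ≤ 1
  R_pos : 0 < h.R
  R_ge : 2 * B / (√w * (1 - h.γ) * √(1 - h.γ * (1 - h.lam) / (1 - h.γ * h.lam))) ≤ h.R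
  η_pos : 0 < h.η
  δ_pos : 0 < h.δ
  β_nonneg : 0 ≤ h.β
  β_lt : h.β < 1

/-- A run of AdaTD(λ) under Markovian observation, for an admissible problem whose limiting
point is `θs`: the states `s 1, s 2, …` form a Markov chain, and the initial parameter lies in
the ball onto which the algorithm projects. -/
structure IsRun {Ω : Type*} [MeasurableSpace Ω] [MeasurableSpace S] (μ : Measure Ω)
    (M : Problem S d) (stat : S → ℝ) (h : Hyper) (B κ ρ w : ℝ) (s : ℕ → Ω → S)
    (θ₁ θs : EuclideanSpace ℝ (Fin d)) : Prop where
  admissible : Admissible M stat B κ ρ w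
  chain : IsMarkovChain μ M.P fun k => s (k + 1)
  init : ‖θ₁‖ ≤ h.R
  limit : M.gLam stat h.γ h.lam θs = 0

/-- The mean squared error `E ‖θ* - θ^k‖²`. -/
def Problem.err {Ω : Type*} [MeasurableSpace Ω] (M : Problem S d) (μ : Measure Ω) (h : Hyper)
    (s : ℕ → Ω → S) (θ₁ θs : EuclideanSpace ℝ (Fin d)) (k : ℕ) : ℝ :=
  ∫ ω, ‖θs - M.theta h θ₁ (fun i => s i ω) k‖ ^ 2 ∂μ

/-- `min_{1 ≤ k ≤ K} e k ≤ ε` for some number of iterations `1 ≤ K ≤ N`. -/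
def ReachesWithin (e : ℕ → ℝ) (ε N : ℝ) : Prop :=
  ∃ K : ℕ, 1 ≤ K ∧ (K : ℝ) ≤ N ∧ (⨅ k : Set.Icc 1 K, e k) ≤ ε

/-- The general complexity `ln⁴(1/ε) / (ε² ln⁴(1/ρ))`. -/
def generalRate (ε ρ : ℝ) : ℝ := Real.log (1 / ε) ^ 4 / (ε ^ 2 * Real.log (1 / ρ) ^ 4)

/-- The complexity under the growth condition `v^k ≤ c k^ν`. -/
def sparseRate (ν ε ρ : ℝ) : ℝ :=
  Real.log (1 / ε) ^ (2 / (1 - ν / 2))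
    / (ε ^ (1 / (1 - ν / 2)) * Real.log (1 / ρ) ^ (2 / (1 - ν / 2)))

end AdaTD

end

set_option linter.unusedSectionVars false

noncomputable section

/-! The proof controls the error weighted by the step size, `1 / √(v n + δ) * ‖θs - θ n‖ ^ 2`. Its
weight is a function of the states up to time `n` only, so it can be treated as known when later
states are averaged.

Along a fixed path the algorithm is a projected gradient method whose rate is normalised by the
accumulated gradients. Its squared steps therefore have a logarithmic sum, and telescoping `‖y - θ‖
^ 2` bounds the sum of rate times `⟪y - θ, g⟫` by `O(log N)` for every `y` in the ball
(`sum_inner_grad_le`). `sum_lagged_le` passes to gradients with a parameter `l` steps old, at the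
price of `(l + 1) ^ 2 * log N`, the approximation error and a small multiple of the weighted error.

In mean, take the lag `2 * τ` and cut the eligibility trace to `τ` states. All states in the lagged
gradient then come more than `τ` steps after its parameter, so ergodicity makes them stationary up
to `κ * ρ ^ τ` (`IsMarkovChain.abs_integral_sub_le`). The stationary direction points to `θs` with
strength `(1 - γ) * w * ‖θs - θ‖ ^ 2`, up to a truncation error (`Admissible.drift_ge`), because `P`
is a contraction of L²(`stat`). The point `θs` lies in the ball (`Admissible.norm_limit_le`), so it
may be used as `y`.

Half of the drift absorbs the weighted error, and `sum_integral_le` remains: the total weighted mean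
error is `O(τ ^ 2 * log N)` plus `N` times `ρ ^ τ` and `γ ^ τ`. If `v k ≤ c * k ^ ν`, the weights
are at least of order `N ^ (-ν / 2)`. Were all errors above `ε`, then `ε * N ^ (1 - ν / 2)` would be
at most of order `τ ^ 2 * log N`. With `τ` of order `log N / log (1 / ρ)` this fails once `N` is the
stated rate times a power of its logarithm (`exists_iterations`). Bounded gradients always give `ν =
1`, which is part (i). -/

namespace AdaTD

/-! ### Pathwise regret of projected adaptive gradient steps with momentum -/

/-- The iterates `θ` of a projected adaptive gradient method with momentum `m`, gradients `g` and
accumulated squared gradient norms `v`. The projection enters only through its contractivity. -/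
structure AdaptiveMomentum {E : Type*} [NormedAddCommGroup E] [InnerProductSpace ℝ E]
    (θ m g : ℕ → E) (v : ℕ → ℝ) (η δ β R G : ℝ) : Prop where
  η_pos : 0 < η
  δ_pos : 0 < δ
  β_nonneg : 0 ≤ β
  β_lt : β < 1
  v_zero : v 0 = 0
  v_succ : ∀ k, v (k + 1) = v k + ‖g k‖ ^ 2
  m_zero : m 0 = 0
  m_succ : ∀ k, m (k + 1) = β • m k + (1 - β) • g k
  theta_le : ∀ k, ‖θ k‖ ≤ R
  grad_le : ∀ k, ‖g k‖ ≤ G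
  contract : ∀ k y, ‖y‖ ≤ R →
    ‖θ (k + 1) - y‖ ≤ ‖θ k + (η / √(v (k + 1) + δ)) • m (k + 1) - y‖

namespace AdaptiveMomentum

variable {E : Type*} [NormedAddCommGroup E] [InnerProductSpace ℝ E]
  {θ m g : ℕ → E} {v : ℕ → ℝ} {η δ β R G : ℝ}

theorem v_nonneg (H : AdaptiveMomentum θ m g v η δ β R G) (k : ℕ) : 0 ≤ v k := by
  induction k with
  | zero => exact H.v_zero.ge
  | succ k ih => rw [H.v_succ]; positivity

theorem v_mono (H : AdaptiveMomentum θ m g v η δ β R G) : Monotone v :=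
  monotone_nat_of_le_succ fun k => by rw [H.v_succ]; linarith [sq_nonneg ‖g k‖]

theorem R_nonneg (H : AdaptiveMomentum θ m g v η δ β R G) : 0 ≤ R :=
  (norm_nonneg _).trans (H.theta_le 0)

theorem G_nonneg (H : AdaptiveMomentum θ m g v η δ β R G) : 0 ≤ G :=
  (norm_nonneg _).trans (H.grad_le 0)

theorem v_le (H : AdaptiveMomentum θ m g v η δ β R G) (k : ℕ) : v k ≤ G ^ 2 * k := by
  induction k with
  | zero => simp [H.v_zero]
  | succ k ih =>
    rw [H.v_succ]
    push_cast
    nlinarith [H.grad_le k, norm_nonneg (g k)]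

theorem m_le (H : AdaptiveMomentum θ m g v η δ β R G) (k : ℕ) : ‖m k‖ ≤ G := by
  induction k with
  | zero => simpa [H.m_zero] using H.G_nonneg
  | succ k ih =>
    rw [H.m_succ]
    calc _ ≤ ‖β • m k‖ + ‖(1 - β) • g k‖ := norm_add_le _ _
      _ = β * ‖m k‖ + (1 - β) * ‖g k‖ := by
          rw [norm_smul, norm_smul, Real.norm_of_nonneg H.β_nonneg,
            Real.norm_of_nonneg (by linarith [H.β_lt])]
      _ ≤ G := by nlinarith [H.β_nonneg, H.β_lt, H.grad_le k]

theorem rate_pos (H : AdaptiveMomentum θ m g v η δ β R G) (k : ℕ) : 0 < 1 / √(v k + δ) := by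
  have := H.v_nonneg k
  have := H.δ_pos
  positivity

theorem rate_anti (H : AdaptiveMomentum θ m g v η δ β R G) :
    Antitone fun k => 1 / √(v k + δ) := fun i j hij => by
  have := H.v_nonneg i
  have := H.δ_pos
  have := H.v_mono hij
  dsimp only
  gcongr

theorem rate_le (H : AdaptiveMomentum θ m g v η δ β R G) (k : ℕ) :
    1 / √(v k + δ) ≤ 1 / √δ := by
  simpa [H.v_zero] using H.rate_anti (Nat.zero_le k)

theorem rate_sq (H : AdaptiveMomentum θ m g v η δ β R G) (k : ℕ) :
    (1 / √(v k + δ)) ^ 2 = 1 / (v k + δ) := by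
  rw [div_pow, Real.sq_sqrt (by linarith [H.v_nonneg k, H.δ_pos]), one_pow]

/-- Each term is the relative increment `1 - x / x'` of `x = v k + δ`, hence at most `log (x' / x)`,
and the logarithms telescope. -/
theorem sum_rate_sq_grad_le (H : AdaptiveMomentum θ m g v η δ β R G) (K : ℕ) :
    ∑ k ∈ Finset.range K, (1 / √(v (k + 1) + δ)) ^ 2 * ‖g k‖ ^ 2
      ≤ Real.log (1 + G ^ 2 * K / δ) := by
  have hδ := H.δ_pos
  have key : ∑ k ∈ Finset.range K, (1 / √(v (k + 1) + δ)) ^ 2 * ‖g k‖ ^ 2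
      ≤ Real.log (v K + δ) - Real.log δ := by
    induction K with
    | zero => simp [H.v_zero]
    | succ K ih =>
      rw [Finset.sum_range_succ]
      have h0 : 0 < v K + δ := by linarith [H.v_nonneg K]
      have h1 : 0 < v (K + 1) + δ := by linarith [H.v_nonneg (K + 1)]
      have h2 := Real.log_le_sub_one_of_pos (div_pos h0 h1)
      rw [Real.log_div h0.ne' h1.ne'] at h2
      have h3 : (1 / √(v (K + 1) + δ)) ^ 2 * ‖g K‖ ^ 2
          = 1 - (v K + δ) / (v (K + 1) + δ) := by
        rw [H.rate_sq, one_sub_div h1.ne', H.v_succ]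
        ring
      linarith
  refine key.trans ?_
  rw [← Real.log_div (by linarith [H.v_nonneg K]) hδ.ne']
  apply Real.log_le_log (div_pos (by linarith [H.v_nonneg K]) hδ)
  rw [add_div, div_self hδ.ne', add_comm]
  gcongr
  exact H.v_le K

theorem norm_m_succ_sq_le (H : AdaptiveMomentum θ m g v η δ β R G) (k : ℕ) :
    ‖m (k + 1)‖ ^ 2 ≤ β * ‖m k‖ ^ 2 + (1 - β) * ‖g k‖ ^ 2 := by
  have h1 : ‖m (k + 1)‖ ≤ β * ‖m k‖ + (1 - β) * ‖g k‖ := by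
    rw [H.m_succ]
    refine (norm_add_le _ _).trans_eq ?_
    rw [norm_smul, norm_smul, Real.norm_of_nonneg H.β_nonneg,
      Real.norm_of_nonneg (by linarith [H.β_lt])]
  calc _ ≤ (β * ‖m k‖ + (1 - β) * ‖g k‖) ^ 2 := by gcongr
    _ ≤ _ := by
      nlinarith [mul_nonneg (mul_nonneg H.β_nonneg (sub_nonneg.2 H.β_lt.le))
        (sq_nonneg (‖m k‖ - ‖g k‖))]

/-- By convexity `‖m‖ ^ 2` is dominated by a geometric average of past `‖g‖ ^ 2`. As the rates
decrease, each past gradient is charged at most at its own rate, so momentum costs nothing over the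
gradient sum. -/
theorem sum_rate_sq_momentum_le (H : AdaptiveMomentum θ m g v η δ β R G) (K : ℕ) :
    ∑ k ∈ Finset.range K, (1 / √(v (k + 1) + δ)) ^ 2 * ‖m (k + 1)‖ ^ 2
      ≤ Real.log (1 + G ^ 2 * K / δ) := by
  refine le_trans ?_ (H.sum_rate_sq_grad_le K)
  have hβ : 0 < 1 - β := by linarith [H.β_lt]
  -- The `β` term is the part of the last momentum not yet charged; keeping it closes the induction.
  have key : (1 - β) * ∑ k ∈ Finset.range K, (1 / √(v (k + 1) + δ)) ^ 2 * ‖m (k + 1)‖ ^ 2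
      + β * ((1 / √(v K + δ)) ^ 2 * ‖m K‖ ^ 2)
      ≤ (1 - β) * ∑ k ∈ Finset.range K, (1 / √(v (k + 1) + δ)) ^ 2 * ‖g k‖ ^ 2 := by
    induction K with
    | zero => simp [H.m_zero]
    | succ K ih =>
      rw [Finset.sum_range_succ, Finset.sum_range_succ, mul_add, mul_add]
      have h1 : (1 / √(v (K + 1) + δ)) ^ 2 ≤ (1 / √(v K + δ)) ^ 2 :=
        pow_le_pow_left₀ (H.rate_pos _).le (H.rate_anti (Nat.le_succ K)) 2
      have h2 := mul_le_mul_of_nonneg_left (H.norm_m_succ_sq_le K)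
        (sq_nonneg (1 / √(v (K + 1) + δ)))
      have h3 : β * ‖m K‖ ^ 2 * (1 / √(v (K + 1) + δ)) ^ 2
          ≤ β * ‖m K‖ ^ 2 * (1 / √(v K + δ)) ^ 2 :=
        mul_le_mul_of_nonneg_left h1 (mul_nonneg H.β_nonneg (sq_nonneg _))
      linarith
  have h4 : 0 ≤ β * ((1 / √(v K + δ)) ^ 2 * ‖m K‖ ^ 2) :=
    mul_nonneg H.β_nonneg (by positivity)
  exact le_of_mul_le_mul_left (by linarith) hβ

theorem norm_step_le (H : AdaptiveMomentum θ m g v η δ β R G) (k : ℕ) :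
    ‖θ (k + 1) - θ k‖ ≤ η * ((1 / √(v (k + 1) + δ)) * ‖m (k + 1)‖) := by
  refine (H.contract k (θ k) (H.theta_le k)).trans_eq ?_
  rw [add_sub_cancel_left, norm_smul, Real.norm_of_nonneg
    (div_nonneg H.η_pos.le (Real.sqrt_nonneg _))]
  ring

theorem norm_sub_le (H : AdaptiveMomentum θ m g v η δ β R G) {y : E} (hy : ‖y‖ ≤ R) (k : ℕ) :
    ‖y - θ k‖ ≤ 2 * R :=
  (_root_.norm_sub_le _ _).trans (by linarith [H.theta_le k])

theorem inner_le (H : AdaptiveMomentum θ m g v η δ β R G) {y u : E} (hy : ‖y‖ ≤ R)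
    (hu : ‖u‖ ≤ G) (k : ℕ) : |inner ℝ (y - θ k) u| ≤ 2 * R * G :=
  (abs_real_inner_le_norm _ _).trans
    (mul_le_mul (H.norm_sub_le hy k) hu (norm_nonneg _) (by linarith [H.R_nonneg]))

/-- Expanding the contraction inequality at `y` bounds each inner product by the decrease of `‖y -
θ‖ ^ 2` plus the squared step, whose sum is logarithmic. -/
theorem sum_inner_momentum_le (H : AdaptiveMomentum θ m g v η δ β R G) {y : E} (hy : ‖y‖ ≤ R)
    (K : ℕ) :
    ∑ k ∈ Finset.range K, 1 / √(v (k + 1) + δ) * inner ℝ (y - θ k) (m (k + 1))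
      ≤ 2 * R ^ 2 / η + η / 2 * Real.log (1 + G ^ 2 * K / δ) := by
  have hη := H.η_pos
  have key : ‖y - θ K‖ ^ 2 + 2 * η * ∑ k ∈ Finset.range K,
        1 / √(v (k + 1) + δ) * inner ℝ (y - θ k) (m (k + 1))
      ≤ ‖y - θ 0‖ ^ 2 + η ^ 2 * ∑ k ∈ Finset.range K,
        (1 / √(v (k + 1) + δ)) ^ 2 * ‖m (k + 1)‖ ^ 2 := by
    induction K with
    | zero => simp
    | succ K ih =>
      rw [Finset.sum_range_succ, Finset.sum_range_succ, mul_add, mul_add]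
      have h1 := pow_le_pow_left₀ (norm_nonneg _) (H.contract K y hy) 2
      have h2 : θ K + (η / √(v (K + 1) + δ)) • m (K + 1) - y
          = (η * (1 / √(v (K + 1) + δ))) • m (K + 1) - (y - θ K) := by
        rw [mul_one_div]; abel
      rw [h2, norm_sub_rev, norm_sub_sq_real _ (y - θ K), norm_smul, real_inner_smul_left, real_inner_comm,
        mul_pow, Real.norm_eq_abs, sq_abs] at h1
      linarith
  have h3 := H.sum_rate_sq_momentum_le K
  have h4 : ‖y - θ 0‖ ^ 2 ≤ (2 * R) ^ 2 :=
    pow_le_pow_left₀ (norm_nonneg _) (H.norm_sub_le hy 0) 2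
  have h5 := mul_le_mul_of_nonneg_left h3 (sq_nonneg η)
  have h6 : 2 * R ^ 2 / η + η / 2 * Real.log (1 + G ^ 2 * K / δ)
      = (4 * R ^ 2 + η ^ 2 * Real.log (1 + G ^ 2 * K / δ)) / (2 * η) := by
    field_simp
    ring
  rw [h6, le_div_iff₀ (by positivity)]
  nlinarith [sq_nonneg ‖y - θ K‖]

/-- Summation by parts in `(1 - β) • g k = m (k + 1) - β • m k`. Shifting the second sum by one step
changes the parameter, which costs a squared step, and the rate, which costs a telescoping multiple
of `2 * R * G`. -/
theorem sum_inner_grad_le (H : AdaptiveMomentum θ m g v η δ β R G) {y : E} (hy : ‖y‖ ≤ R)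
    (K : ℕ) :
    ∑ k ∈ Finset.range K, 1 / √(v (k + 1) + δ) * inner ℝ (y - θ k) (g k)
      ≤ 2 * R ^ 2 / η + 4 * R * G / √δ / (1 - β)
        + (η / 2 + η / (1 - β)) * Real.log (1 + G ^ 2 * K / δ) := by
  have hη := H.η_pos
  have hβ : 0 < 1 - β := by linarith [H.β_lt]
  have hβ0 := H.β_nonneg
  have hRG : 0 ≤ 2 * R * G := mul_nonneg (by linarith [H.R_nonneg]) H.G_nonneg
  -- The summation by parts has a boundary term at the last step, so at least one step is needed.
  rcases K with _ | K
  · have := H.R_nonneg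
    have := H.G_nonneg
    simp only [Finset.range_zero, Finset.sum_empty, Nat.cast_zero, mul_zero, zero_div, add_zero,
      Real.log_one]
    positivity
  have key : (1 - β) * ∑ k ∈ Finset.range (K + 1),
        1 / √(v (k + 1) + δ) * inner ℝ (y - θ k) (g k)
      ≤ (1 - β) * ∑ k ∈ Finset.range (K + 1),
          1 / √(v (k + 1) + δ) * inner ℝ (y - θ k) (m (k + 1))
        + β * (1 / √(v (K + 1) + δ) * inner ℝ (y - θ K) (m (K + 1)))
        + 2 * R * G * (1 / √(v 1 + δ) - 1 / √(v (K + 1) + δ))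
        + η * ∑ k ∈ Finset.range K, (1 / √(v (k + 1) + δ)) ^ 2 * ‖m (k + 1)‖ ^ 2 := by
    induction K with
    | zero =>
      simp only [zero_add, Finset.sum_range_one, sub_self, mul_zero, add_zero]
      have h1 : m 1 = (1 - β) • g 0 := by simpa [H.m_zero] using H.m_succ 0
      have h2 : inner ℝ (y - θ 0) (m 1) = (1 - β) * inner ℝ (y - θ 0) (g 0) := by
        rw [h1, real_inner_smul_right]
      simp only [Finset.range_zero, Finset.sum_empty, mul_zero, add_zero]
      rw [h2]
      linarith
    | succ K ih =>
      rw [Finset.sum_range_succ _ (K + 1), Finset.sum_range_succ _ (K + 1),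
        Finset.sum_range_succ (fun k => (1 / √(v (k + 1) + δ)) ^ 2 * ‖m (k + 1)‖ ^ 2) K, mul_add, mul_add, mul_add]
      have h1 : inner ℝ (y - θ (K + 1)) (m (K + 1 + 1))
          = β * inner ℝ (y - θ (K + 1)) (m (K + 1))
            + (1 - β) * inner ℝ (y - θ (K + 1)) (g (K + 1)) := by
        rw [H.m_succ (K + 1), inner_add_right, real_inner_smul_right, real_inner_smul_right]
      have h2 : inner ℝ (y - θ (K + 1)) (m (K + 1))
          = inner ℝ (y - θ K) (m (K + 1)) - inner ℝ (θ (K + 1) - θ K) (m (K + 1)) := by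
        rw [← inner_sub_left]
        congr 1
        abel
      have hr := H.rate_pos (K + 1)
      have hr2 := H.rate_anti (Nat.le_succ (K + 1))
      have h3 : inner ℝ (θ (K + 1) - θ K) (m (K + 1))
          ≤ η * (1 / √(v (K + 1) + δ)) * ‖m (K + 1)‖ ^ 2 := by
        refine (real_inner_le_norm _ _).trans ?_
        nlinarith [H.norm_step_le K, norm_nonneg (m (K + 1))]
      have h4 := (abs_le.1 (H.inner_le hy (H.m_le (K + 1)) (K + 1))).2
      set a := 1 / √(v (K + 1) + δ)
      set a' := 1 / √(v (K + 1 + 1) + δ)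
      have h5 : (a - a') * inner ℝ (y - θ (K + 1)) (m (K + 1)) ≤ (a - a') * (2 * R * G) :=
        mul_le_mul_of_nonneg_left h4 (sub_nonneg.2 hr2)
      have h6 := mul_le_mul_of_nonneg_left h3 hr.le
      have h7 : a * inner ℝ (y - θ K) (m (K + 1)) ≤ a' * inner ℝ (y - θ (K + 1)) (m (K + 1))
          + (a - a') * (2 * R * G) + η * (a ^ 2 * ‖m (K + 1)‖ ^ 2) := by
        have : a * inner ℝ (y - θ (K + 1)) (m (K + 1)) = a * inner ℝ (y - θ K) (m (K + 1))
          - a * inner ℝ (θ (K + 1) - θ K) (m (K + 1)) := by rw [h2]; ring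
        linarith
      have h8 : 0 ≤ (a - a') * (2 * R * G) := mul_nonneg (sub_nonneg.2 hr2) hRG
      have h9 : 0 ≤ η * (a ^ 2 * ‖m (K + 1)‖ ^ 2) := by positivity
      have h10 := mul_le_mul_of_nonneg_left h7 hβ0
      have h11 : (1 - β) * (a' * inner ℝ (y - θ (K + 1)) (g (K + 1)))
          = a' * inner ℝ (y - θ (K + 1)) (m (K + 1 + 1))
            - β * (a' * inner ℝ (y - θ (K + 1)) (m (K + 1))) := by rw [h1]; ring
      nlinarith [mul_nonneg hβ.le h8, mul_nonneg hβ.le h9]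
  have hlog : ∑ k ∈ Finset.range K, (1 / √(v (k + 1) + δ)) ^ 2 * ‖m (k + 1)‖ ^ 2
      ≤ Real.log (1 + G ^ 2 * (K + 1 : ℕ) / δ) :=
    (Finset.sum_le_sum_of_subset_of_nonneg (Finset.range_mono (Nat.le_succ K))
      fun _ _ _ => by positivity).trans (H.sum_rate_sq_momentum_le (K + 1))
  have hY : 1 / √(v (K + 1) + δ) * inner ℝ (y - θ K) (m (K + 1)) ≤ 1 / √δ * (2 * R * G) :=
    (mul_le_mul_of_nonneg_left (abs_le.1 (H.inner_le hy (H.m_le (K + 1)) K)).2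
      (H.rate_pos _).le).trans (mul_le_mul_of_nonneg_right (H.rate_le _) hRG)
  have hY0 : 0 ≤ 1 / √δ * (2 * R * G) := by positivity
  have hsum := H.sum_inner_momentum_le hy (K + 1)
  have hr : 2 * R * G * (1 / √(v 1 + δ) - 1 / √(v (K + 1) + δ)) ≤ 1 / √δ * (2 * R * G) := by
    rw [mul_comm]
    exact mul_le_mul_of_nonneg_right (by linarith [H.rate_le 1, H.rate_pos (K + 1)]) hRG
  set Λ := Real.log (1 + G ^ 2 * (K + 1 : ℕ) / δ)
  have hA : 2 * R ^ 2 / η + 4 * R * G / √δ / (1 - β) + (η / 2 + η / (1 - β)) * Λ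
      = (2 * R ^ 2 / η + η / 2 * Λ) + (2 * (1 / √δ * (2 * R * G)) + η * Λ) / (1 - β) := by
    field_simp
    ring
  rw [hA, ← sub_le_iff_le_add', le_div_iff₀ hβ]
  nlinarith [mul_le_mul_of_nonneg_left hY hβ0, mul_nonneg hβ.le hY0,
    mul_le_mul_of_nonneg_left hlog hη.le, mul_le_mul_of_nonneg_left hsum hβ.le]

/-! ### Gradients evaluated with a delayed parameter -/

theorem norm_sub_sq_le_sum (H : AdaptiveMomentum θ m g v η δ β R G) (n l : ℕ) :
    ‖θ (n + l) - θ n‖ ^ 2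
      ≤ l * ∑ j ∈ Finset.range l,
        η ^ 2 * ((1 / √(v (n + j + 1) + δ)) ^ 2 * ‖m (n + j + 1)‖ ^ 2) := by
  have h1 : ‖θ (n + l) - θ n‖
      ≤ ∑ j ∈ Finset.range l, η * ((1 / √(v (n + j + 1) + δ)) * ‖m (n + j + 1)‖) := by
    have := Finset.sum_range_sub (fun j => θ (n + j)) l
    simp only [add_zero] at this
    rw [← this]
    exact (norm_sum_le _ _).trans (Finset.sum_le_sum fun j _ => H.norm_step_le (n + j))
  refine (pow_le_pow_left₀ (norm_nonneg _) h1 2).trans ?_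
  refine (sq_sum_le_card_mul_sum_sq).trans_eq ?_
  rw [Finset.card_range]
  congr 1
  exact Finset.sum_congr rfl fun j _ => by ring

/-- After Cauchy–Schwarz and an exchange of sums, each offset `j < l` contributes part of the same
logarithmic sum. Thus displacements over `l` steps stay summable up to a logarithm although single
steps need not be small. -/
theorem sum_norm_sub_sq_le (H : AdaptiveMomentum θ m g v η δ β R G) (N l : ℕ) :
    ∑ n ∈ Finset.range N, ‖θ (n + l) - θ n‖ ^ 2
      ≤ l ^ 2 * (η ^ 2 * Real.log (1 + G ^ 2 * (N + l : ℕ) / δ)) := by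
  refine (Finset.sum_le_sum fun n _ => H.norm_sub_sq_le_sum n l).trans ?_
  rw [← Finset.mul_sum, Finset.sum_comm, pow_two (l : ℝ), mul_assoc (l : ℝ)]
  refine mul_le_mul_of_nonneg_left ?_ (Nat.cast_nonneg (α := ℝ) l)
  have : ∀ j ∈ Finset.range l, ∑ n ∈ Finset.range N,
      η ^ 2 * ((1 / √(v (n + j + 1) + δ)) ^ 2 * ‖m (n + j + 1)‖ ^ 2)
      ≤ η ^ 2 * Real.log (1 + G ^ 2 * (N + l : ℕ) / δ) := fun j hj => by
    rw [← Finset.mul_sum]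
    refine mul_le_mul_of_nonneg_left (le_trans ?_ (H.sum_rate_sq_momentum_le (N + l)))
      (sq_nonneg _)
    have hj' := Finset.mem_range.1 hj
    refine (Finset.sum_le_sum_of_subset_of_nonneg
      (f := fun k => (1 / √(v (k + 1) + δ)) ^ 2 * ‖m (k + 1)‖ ^ 2)
      (s := (Finset.range N).map (addRightEmbedding j)) ?_ fun _ _ _ => by positivity).trans' ?_
    · intro k hk
      simp only [Finset.mem_map, Finset.mem_range, addRightEmbedding_apply] at hk ⊢
      omega
    · rw [Finset.sum_map]
      simp
  simpa using Finset.sum_le_sum this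

/-- The weight `1 / √(v n + δ)` must belong to the past, whereas the regret bound carries the rate
of step `n + l`. The exchange costs a rate difference, a gradient discrepancy and a displacement;
Young's inequality moves the discrepancy into the `μ / 2` term and squared displacements. -/
theorem lagged_term_le (H : AdaptiveMomentum θ m g v η δ β R G) {y : E} (hy : ‖y‖ ≤ R)
    {f : ℕ → E} {L e μ : ℝ} {l : ℕ} (hμ : 0 < μ) (hL : 0 ≤ L) (he : 0 ≤ e)
    (hf : ∀ n, ‖f n‖ ≤ G)
    (hfg : ∀ n, ‖f n - g (n + l)‖ ≤ L * ‖θ (n + l) - θ n‖ + e) (n : ℕ) :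
    1 / √(v n + δ) * inner ℝ (y - θ n) (f n)
      ≤ μ / 2 * (1 / √(v n + δ) * ‖y - θ n‖ ^ 2)
        + 1 / √(v (n + l + 1) + δ) * inner ℝ (y - θ (n + l)) (g (n + l))
        + (1 / √(v n + δ) - 1 / √(v (n + l + 1) + δ)) * (2 * R * G)
        + 1 / 2 * ((1 / √(v (n + l + 1) + δ)) ^ 2 * ‖g (n + l)‖ ^ 2)
        + (1 / 2 + L ^ 2 / (2 * μ * √δ)) * ‖θ (n + l) - θ n‖ ^ 2
        + 2 * R * e / √δ := by
  have hδ := H.δ_pos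
  have hR := H.R_nonneg
  have hsδ : 0 < √δ := Real.sqrt_pos.2 hδ
  have hb := H.rate_pos n
  have ha := H.rate_pos (n + l + 1)
  have hba : 1 / √(v (n + l + 1) + δ) ≤ 1 / √(v n + δ) := H.rate_anti (by omega)
  have hbδ := H.rate_le n
  set b := 1 / √(v n + δ)
  set a := 1 / √(v (n + l + 1) + δ)
  set D := ‖θ (n + l) - θ n‖
  have hD : 0 ≤ D := norm_nonneg _
  set u := ‖y - θ n‖
  have hu : 0 ≤ u := norm_nonneg _
  have huR : u ≤ 2 * R := H.norm_sub_le hy n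
  -- Four exchanges: regret term, change of rate, change of gradient, change of base point.
  have h1 : b * inner ℝ (y - θ n) (f n)
      = a * inner ℝ (y - θ (n + l)) (g (n + l)) + (b - a) * inner ℝ (y - θ n) (f n)
        + a * inner ℝ (y - θ n) (f n - g (n + l))
        + a * inner ℝ (θ (n + l) - θ n) (g (n + l)) := by
    simp only [inner_sub_left, inner_sub_right]
    ring
  have h2 : (b - a) * inner ℝ (y - θ n) (f n) ≤ (b - a) * (2 * R * G) :=
    mul_le_mul_of_nonneg_left (abs_le.1 (H.inner_le hy (hf n) n)).2 (sub_nonneg.2 hba)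
  have h3 : a * inner ℝ (y - θ n) (f n - g (n + l)) ≤ b * (u * (L * D + e)) := by
    have : inner ℝ (y - θ n) (f n - g (n + l)) ≤ u * (L * D + e) :=
      (real_inner_le_norm _ _).trans (mul_le_mul_of_nonneg_left (hfg n) hu)
    exact (mul_le_mul_of_nonneg_left this ha.le).trans
      (mul_le_mul_of_nonneg_right hba (by positivity))
  have h4 : a * inner ℝ (θ (n + l) - θ n) (g (n + l))
      ≤ 1 / 2 * (a ^ 2 * ‖g (n + l)‖ ^ 2) + 1 / 2 * D ^ 2 := by
    have : inner ℝ (θ (n + l) - θ n) (g (n + l)) ≤ D * ‖g (n + l)‖ := real_inner_le_norm _ _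
    have := mul_le_mul_of_nonneg_left this ha.le
    nlinarith [sq_nonneg (a * ‖g (n + l)‖ - D)]
  have h5 : b * (u * e) ≤ 2 * R * e / √δ := by
    have : b * (u * e) ≤ 1 / √δ * (2 * R * e) := by gcongr
    exact this.trans_eq (by ring)
  have h6 : b * (u * (L * D)) ≤ μ / 2 * (b * u ^ 2) + L ^ 2 / (2 * μ * √δ) * D ^ 2 := by
    have h7 : u * (L * D) ≤ μ / 2 * u ^ 2 + L ^ 2 * D ^ 2 / (2 * μ) := by
      rw [← sub_nonneg]
      have : μ / 2 * u ^ 2 + L ^ 2 * D ^ 2 / (2 * μ) - u * (L * D)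
          = (μ * u - L * D) ^ 2 / (2 * μ) := by
        field_simp
        ring
      rw [this]
      positivity
    have h8 : b * (L ^ 2 * D ^ 2 / (2 * μ)) ≤ 1 / √δ * (L ^ 2 * D ^ 2 / (2 * μ)) := by gcongr
    have h9 : 1 / √δ * (L ^ 2 * D ^ 2 / (2 * μ)) = L ^ 2 / (2 * μ * √δ) * D ^ 2 := by
      field_simp
    nlinarith [mul_le_mul_of_nonneg_left h7 hb.le]
  rw [h1]
  nlinarith

/-- The constant of `sum_lagged_le`. -/
def _root_.AdaTD.lagConst (η δ β R G L μ : ℝ) : ℝ :=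
  2 * R ^ 2 / η + 4 * R * G / √δ / (1 - β) + 4 * R * G / √δ
    + (η / 2 + η / (1 - β) + 1 / 2 + (1 / 2 + L ^ 2 / (2 * μ * √δ)) * η ^ 2)

theorem lag_arith {l Λ A B F D : ℝ} (hl : 0 ≤ l) (hΛ : 0 ≤ Λ) (hA : 0 ≤ A) (hB : 0 ≤ B)
    (hF : 0 ≤ F) (hD : 0 ≤ D) :
    A + (2 * l + 1) * F + B * Λ + D * (l ^ 2 * Λ)
      ≤ (A + 2 * F + (B + D)) * (l + 1) ^ 2 * (1 + Λ) := by
  have hlΛ := mul_nonneg hl hΛ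
  have w1 : 1 ≤ (l + 1) ^ 2 * (1 + Λ) := by nlinarith [mul_nonneg hl hlΛ]
  have w2 : 2 * l + 1 ≤ 2 * ((l + 1) ^ 2 * (1 + Λ)) := by nlinarith [mul_nonneg hl hlΛ]
  have w3 : Λ ≤ (l + 1) ^ 2 * (1 + Λ) := by nlinarith [mul_nonneg hl hlΛ]
  have w4 : l ^ 2 * Λ ≤ (l + 1) ^ 2 * (1 + Λ) := by nlinarith [mul_nonneg hl hlΛ]
  have h1 := mul_le_mul_of_nonneg_left w1 hA
  have h2 := mul_le_mul_of_nonneg_left w2 hF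
  have h3 := mul_le_mul_of_nonneg_left w3 hB
  have h4 := mul_le_mul_of_nonneg_left w4 hD
  linarith

theorem sum_lagged_le (H : AdaptiveMomentum θ m g v η δ β R G) {y : E} (hy : ‖y‖ ≤ R)
    {f : ℕ → E} {L e μ : ℝ} {l : ℕ} (hμ : 0 < μ) (hL : 0 ≤ L) (he : 0 ≤ e)
    (hf : ∀ n, ‖f n‖ ≤ G)
    (hfg : ∀ n, ‖f n - g (n + l)‖ ≤ L * ‖θ (n + l) - θ n‖ + e) (N : ℕ) :
    ∑ n ∈ Finset.range N, 1 / √(v n + δ) * inner ℝ (y - θ n) (f n)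
      ≤ μ / 2 * ∑ n ∈ Finset.range N, 1 / √(v n + δ) * ‖y - θ n‖ ^ 2
        + lagConst η δ β R G L μ * (l + 1) ^ 2 * (1 + Real.log (1 + G ^ 2 * (N + l : ℕ) / δ))
        + N * (2 * R * e / √δ) := by
  have hη := H.η_pos
  have hδ := H.δ_pos
  have hβ : 0 < 1 - β := by linarith [H.β_lt]
  have hR := H.R_nonneg
  have hG := H.G_nonneg
  have hsδ : 0 < √δ := Real.sqrt_pos.2 hδ
  have hRG : 0 ≤ 2 * R * G := by positivity
  have hsum := Finset.sum_le_sum fun n (_ : n ∈ Finset.range N) => H.lagged_term_le hy hμ hL he hf hfg n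
  simp only [Finset.sum_add_distrib, ← Finset.mul_sum, ← Finset.sum_mul] at hsum
  -- The regret bound starts at index `0`; the `l` initial terms missing here are bounded trivially.
  have s1 : ∑ n ∈ Finset.range N, 1 / √(v (n + l + 1) + δ) * inner ℝ (y - θ (n + l)) (g (n + l))
      ≤ 2 * R ^ 2 / η + 4 * R * G / √δ / (1 - β)
        + (η / 2 + η / (1 - β)) * Real.log (1 + G ^ 2 * (N + l : ℕ) / δ)
        + l * (2 * R * G / √δ) := by
    have h1 := H.sum_inner_grad_le hy (N + l)
    rw [add_comm N l, Finset.sum_range_add] at h1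
    have h2 : ∀ k ∈ Finset.range l, -(2 * R * G / √δ)
        ≤ 1 / √(v (k + 1) + δ) * inner ℝ (y - θ k) (g k) := fun k _ => by
      have h3 := (abs_le.1 (H.inner_le hy (H.grad_le k) k)).1
      have h4 := mul_le_mul_of_nonneg_left h3 (H.rate_pos (k + 1)).le
      have h5 := mul_le_mul_of_nonneg_right (H.rate_le (k + 1)) hRG
      have h6 : 1 / √δ * (2 * R * G) = 2 * R * G / √δ := by ring
      linarith
    have h3 := Finset.sum_le_sum h2
    simp only [Finset.sum_const, Finset.card_range, nsmul_eq_mul] at h3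
    simp only [add_comm l] at h1
    linarith
  have s2 : ∑ n ∈ Finset.range N, (1 / √(v n + δ) - 1 / √(v (n + l + 1) + δ))
      ≤ (l + 1) * (1 / √δ) := by
    -- A difference of rates with gap `p` telescopes `p` times, each time leaving at most one
    -- initial rate.
    have h1 : ∀ p : ℕ, ∑ n ∈ Finset.range N, (1 / √(v n + δ) - 1 / √(v (n + p) + δ))
        ≤ p * (1 / √δ) := fun p => by
      induction p with
      | zero => simp
      | succ p ih =>
        have h2 : ∑ n ∈ Finset.range N, (1 / √(v n + δ) - 1 / √(v (n + (p + 1)) + δ))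
            = ∑ n ∈ Finset.range N, (1 / √(v n + δ) - 1 / √(v (n + p) + δ))
              - ∑ n ∈ Finset.range N, (1 / √(v (n + 1 + p) + δ) - 1 / √(v (n + p) + δ)) := by
          rw [← Finset.sum_sub_distrib]
          refine Finset.sum_congr rfl fun n _ => ?_
          rw [add_right_comm, add_assoc]
          ring
        rw [h2, Finset.sum_range_sub (fun n => 1 / √(v (n + p) + δ))]
        push_cast
        have := H.rate_le (0 + p)
        have := H.rate_pos (N + p)
        linarith
    exact_mod_cast h1 (l + 1)
  have s3 : ∑ n ∈ Finset.range N, (1 / √(v (n + l + 1) + δ)) ^ 2 * ‖g (n + l)‖ ^ 2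
      ≤ Real.log (1 + G ^ 2 * (N + l : ℕ) / δ) := by
    have h1 := H.sum_rate_sq_grad_le (N + l)
    rw [add_comm N l, Finset.sum_range_add] at h1
    have h2 : 0 ≤ ∑ k ∈ Finset.range l, (1 / √(v (k + 1) + δ)) ^ 2 * ‖g k‖ ^ 2 :=
      Finset.sum_nonneg fun _ _ => by positivity
    simp only [add_comm l] at h1
    linarith
  have s4 := H.sum_norm_sub_sq_le N l
  set Λ := Real.log (1 + G ^ 2 * (N + l : ℕ) / δ)
  have hΛ : 0 ≤ Λ := Real.log_nonneg (by
    have : 0 ≤ G ^ 2 * (N + l : ℕ) / δ := by positivity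
    linarith)
  have hc : 0 ≤ 1 / 2 + L ^ 2 / (2 * μ * √δ) := by positivity
  have s2' := mul_le_mul_of_nonneg_right s2 hRG
  have s4' := mul_le_mul_of_nonneg_left s4 hc
  simp only [Finset.sum_const, Finset.card_range, nsmul_eq_mul] at hsum
  have hl : (0 : ℝ) ≤ l := Nat.cast_nonneg l
  have e1 : (0:ℝ) ≤ 2 * R ^ 2 / η + 4 * R * G / √δ / (1 - β) := by positivity
  have e2 : (0:ℝ) ≤ η / 2 + η / (1 - β) + 1 / 2 := by positivity
  have e3 : (0:ℝ) ≤ 2 * R * G / √δ := by positivity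
  have e4 : (0:ℝ) ≤ (1 / 2 + L ^ 2 / (2 * μ * √δ)) * η ^ 2 := by positivity
  unfold lagConst
  set A := 2 * R ^ 2 / η + 4 * R * G / √δ / (1 - β)
  set c := 1 / 2 + L ^ 2 / (2 * μ * √δ)
  set B := η / 2 + η / (1 - β)
  have e5 : 4 * R * G / √δ = 2 * (2 * R * G / √δ) := by ring
  have e6 : ((l:ℝ) + 1) * (1 / √δ) * (2 * R * G) = (l + 1) * (2 * R * G / √δ) := by ring
  rw [e6] at s2'
  rw [e5]
  set F := 2 * R * G / √δ
  linarith [lag_arith hl hΛ e1 e2 e3 e4]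

end AdaptiveMomentum
variable {S : Type*} [Fintype S] [DecidableEq S] {d : ℕ}

/-! ### Stochastic matrices and the weighted inner product -/

/-- The inner product of functions on `S` with weights `stat`. -/
def wdot (stat f g : S → ℝ) : ℝ := ∑ s, stat s * (f s * g s)

theorem abs_mulVec_le {P : Matrix S S ℝ} (hP : P ∈ rowStochastic ℝ S) {f : S → ℝ} {c : ℝ}
    (hf : ∀ s, |f s| ≤ c) (s : S) : |(P *ᵥ f) s| ≤ c := by
  calc |∑ s', P s s' * f s'| ≤ ∑ s', |P s s' * f s'| := Finset.abs_sum_le_sum_abs _ _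
    _ ≤ ∑ s', P s s' * c := Finset.sum_le_sum fun s' _ => by
        rw [abs_mul, abs_of_nonneg (nonneg_of_mem_rowStochastic hP)]
        exact mul_le_mul_of_nonneg_left (hf s') (nonneg_of_mem_rowStochastic hP)
    _ = c := by rw [← Finset.sum_mul, sum_row_of_mem_rowStochastic hP, one_mul]

theorem sq_mulVec_le {P : Matrix S S ℝ} (hP : P ∈ rowStochastic ℝ S) (f : S → ℝ) (s : S) :
    (P *ᵥ f) s ^ 2 ≤ (P *ᵥ fun s' => f s' ^ 2) s := by
  have := (even_two.convexOn_pow (𝕜 := ℝ)).map_sum_le (t := Finset.univ) (w := fun s' => P s s')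
    (p := f) (fun _ _ => nonneg_of_mem_rowStochastic hP) (sum_row_of_mem_rowStochastic hP s)
    (fun _ _ => Set.mem_univ _)
  simpa [mulVec, dotProduct] using this

theorem vecMul_pow_eq {P : Matrix S S ℝ} {stat : S → ℝ} (h : stat ᵥ* P = stat) (t : ℕ) :
    stat ᵥ* (P ^ t) = stat := by
  induction t with
  | zero => simp
  | succ t ih => rw [pow_succ, ← vecMul_vecMul, ih, h]

theorem sum_stat_mulVec {P : Matrix S S ℝ} {stat : S → ℝ} (h : stat ᵥ* P = stat) (f : S → ℝ) :
    ∑ s, stat s * (P *ᵥ f) s = ∑ s, stat s * f s := by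
  change stat ⬝ᵥ (P *ᵥ f) = stat ⬝ᵥ f
  rw [dotProduct_mulVec, h]

/-- Jensen's inequality in each row, then invariance of `stat`: `P` is a contraction of L²(`stat`).
-/
theorem wdot_mulVec_self_le {P : Matrix S S ℝ} {stat : S → ℝ} (hP : P ∈ rowStochastic ℝ S)
    (h0 : ∀ s, 0 ≤ stat s) (h : stat ᵥ* P = stat) (f : S → ℝ) :
    wdot stat (P *ᵥ f) (P *ᵥ f) ≤ wdot stat f f := by
  simp only [wdot, ← sq]
  rw [← sum_stat_mulVec h fun s => f s ^ 2]
  exact Finset.sum_le_sum fun s _ => mul_le_mul_of_nonneg_left (sq_mulVec_le hP f s) (h0 s)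

theorem wdot_mulVec_le {P : Matrix S S ℝ} {stat : S → ℝ} (hP : P ∈ rowStochastic ℝ S)
    (h0 : ∀ s, 0 ≤ stat s) (h : stat ᵥ* P = stat) (f : S → ℝ) :
    wdot stat f (P *ᵥ f) ≤ wdot stat f f := by
  have h1 : 2 * wdot stat f (P *ᵥ f) ≤ wdot stat f f + wdot stat (P *ᵥ f) (P *ᵥ f) := by
    simp only [wdot, Finset.mul_sum, ← Finset.sum_add_distrib]
    refine Finset.sum_le_sum fun s _ => ?_
    nlinarith [mul_nonneg (h0 s) (sq_nonneg (f s - (P *ᵥ f) s))]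
  linarith [wdot_mulVec_self_le hP h0 h f]

theorem wdot_self_nonneg {stat : S → ℝ} (h0 : ∀ s, 0 ≤ stat s) (f : S → ℝ) :
    0 ≤ wdot stat f f :=
  Finset.sum_nonneg fun s _ => mul_nonneg (h0 s) (mul_self_nonneg _)

theorem wdot_le_of_abs_le {stat : S → ℝ} (h0 : ∀ s, 0 ≤ stat s) (h1 : ∑ s, stat s = 1)
    {f g : S → ℝ} {a b : ℝ} (hf : ∀ s, |f s| ≤ a) (hg : ∀ s, |g s| ≤ b) :
    |wdot stat f g| ≤ a * b := by
  calc |wdot stat f g| ≤ ∑ s, |stat s * (f s * g s)| := Finset.abs_sum_le_sum_abs _ _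
    _ ≤ ∑ s, stat s * (a * b) := Finset.sum_le_sum fun s _ => by
        rw [abs_mul, abs_of_nonneg (h0 s), abs_mul]
        exact mul_le_mul_of_nonneg_left (mul_le_mul (hf s) (hg s) (abs_nonneg _)
          ((abs_nonneg _).trans (hf s))) (h0 s)
    _ = a * b := by rw [← Finset.sum_mul, h1, one_mul]

theorem wdot_le_sqrt_mul {stat : S → ℝ} (h0 : ∀ s, 0 ≤ stat s) (h1 : ∑ s, stat s = 1)
    {f g : S → ℝ} {b : ℝ} (hb : 0 ≤ b) (hg : ∀ s, |g s| ≤ b) :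
    wdot stat f g ≤ √(wdot stat f f) * b := by
  have h2 : wdot stat f g ^ 2 ≤ wdot stat f f * wdot stat g g :=
    Finset.sum_sq_le_sum_mul_sum_of_sq_le_mul _
      (fun s _ => mul_nonneg (h0 s) (mul_self_nonneg _))
      (fun s _ => mul_nonneg (h0 s) (mul_self_nonneg _)) fun s _ => (by ring : _ = _).le
  have h3 : wdot stat g g ≤ b ^ 2 :=
    (le_abs_self _).trans ((wdot_le_of_abs_le h0 h1 hg hg).trans_eq (sq b).symm)
  have h4 : wdot stat f g ≤ √(wdot stat f f * b ^ 2) := Real.le_sqrt_of_sq_le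
    (h2.trans (mul_le_mul_of_nonneg_left h3 (wdot_self_nonneg h0 f)))
  rwa [Real.sqrt_mul (wdot_self_nonneg h0 f), Real.sqrt_sq hb] at h4

/-- The discounted autocorrelations of a function under a Markov chain dominate those of a
constant. -/
theorem discounted_corr_ge {q : ℕ → ℝ} {γ x : ℝ} (hx : 0 ≤ x) (hxγ : x ≤ γ)
    (hq : ∀ j, q j ≤ q 0) (τ : ℕ) :
    (1 - γ) * (∑ j ∈ Finset.range τ, x ^ j) * q 0
      ≤ ∑ j ∈ Finset.range τ, x ^ j * (q j - γ * q (j + 1)) := by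
  rcases τ with _ | n
  · simp
  -- On the right each `q j` with `j ≥ 1` has a coefficient `≤ 0`, as `x ≤ γ`, so replacing it by `q
  -- 0` only lowers the sum. The extra term keeps the last, not yet replaced, `q (n + 1)`.
  have key : (1 - γ) * (∑ j ∈ Finset.range (n + 1), x ^ j) * q 0 + γ * x ^ n * (q 0 - q (n + 1))
      ≤ ∑ j ∈ Finset.range (n + 1), x ^ j * (q j - γ * q (j + 1)) := by
    induction n with
    | zero => simp; linarith
    | succ n ih =>
      rw [Finset.sum_range_succ, Finset.sum_range_succ _ (n + 1)]
      have h1 : 0 ≤ x ^ n * ((γ - x) * (q 0 - q (n + 1))) :=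
        mul_nonneg (pow_nonneg hx n) (mul_nonneg (sub_nonneg.2 hxγ) (sub_nonneg.2 (hq _)))
      rw [pow_succ]
      nlinarith
  have := mul_nonneg (mul_nonneg (hx.trans hxγ) (pow_nonneg hx n)) (sub_nonneg.2 (hq (n + 1)))
  linarith

theorem GeomErgodic.vecMul_eq [Nonempty S] {P : Matrix S S ℝ} {stat : S → ℝ} {κ ρ : ℝ}
    (h : GeomErgodic P stat κ ρ) : stat ᵥ* P = stat := by
  obtain ⟨s⟩ := ‹Nonempty S›
  funext s'
  refine tendsto_nhds_unique ?_ ((tendsto_add_atTop_iff_nat 1).2 (h.tendsto s s'))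
  simp only [pow_succ, mul_apply]
  exact tendsto_finsetSum _ fun u _ => (h.tendsto s u).mul_const _

theorem GeomErgodic.sum_eq_one [Nonempty S] {P : Matrix S S ℝ} {stat : S → ℝ} {κ ρ : ℝ}
    (hP : P ∈ rowStochastic ℝ S) (h : GeomErgodic P stat κ ρ) : ∑ s, stat s = 1 := by
  obtain ⟨s⟩ := ‹Nonempty S›
  have h1 := tendsto_finsetSum Finset.univ fun u _ => h.tendsto s u
  simp only [sum_row_of_mem_rowStochastic (pow_mem hP _)] at h1
  exact tendsto_nhds_unique h1 tendsto_const_nhds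

/-! ### Linear function approximation -/

/-- The approximate value function `Φ θ`. -/
def Problem.feat (M : Problem S d) (θ : EuclideanSpace ℝ (Fin d)) (s : S) : ℝ :=
  inner ℝ (M.φ s) θ

theorem Problem.Phi_mulVec (M : Problem S d) (θ : EuclideanSpace ℝ (Fin d)) :
    (M.Phi *ᵥ fun j => θ j) = M.feat θ := by
  funext s
  simp [Problem.Phi, Problem.feat, mulVec, dotProduct, PiLp.inner_apply, mul_comm]

theorem Problem.feat_sub (M : Problem S d) (θ θ' : EuclideanSpace ℝ (Fin d)) :
    M.feat (θ - θ') = M.feat θ - M.feat θ' := by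
  funext s
  simp [Problem.feat, inner_sub_right]

theorem Problem.inner_covariance (M : Problem S d) (stat : S → ℝ)
    (u : EuclideanSpace ℝ (Fin d)) :
    (fun j => u j) ⬝ᵥ ((M.Phiᵀ * Matrix.diagonal stat * M.Phi) *ᵥ fun j => u j)
      = wdot stat (M.feat u) (M.feat u) := by
  rw [← mulVec_mulVec, ← mulVec_mulVec, dotProduct_mulVec, vecMul_transpose, M.Phi_mulVec]
  simp [dotProduct, mulVec_diagonal, wdot]
  exact Finset.sum_congr rfl fun s _ => by ring

theorem Problem.inner_gLam (M : Problem S d) (stat : S → ℝ) (γ lam : ℝ)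
    (u θ : EuclideanSpace ℝ (Fin d)) :
    (fun j => u j) ⬝ᵥ M.gLam stat γ lam θ
      = wdot stat (M.feat u) (M.bellmanLam γ lam (M.feat θ) - M.feat θ) := by
  rw [Problem.gLam, ← mulVec_mulVec, dotProduct_mulVec, vecMul_transpose, M.Phi_mulVec,
    M.Phi_mulVec]
  simp [dotProduct, mulVec_diagonal, wdot]
  exact Finset.sum_congr rfl fun s _ => by ring

theorem Problem.isHermitian_covariance (M : Problem S d) (stat : S → ℝ) :
    (M.Phiᵀ * Matrix.diagonal stat * M.Phi).IsHermitian := by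
  rw [Matrix.IsHermitian, conjTranspose_eq_transpose_of_trivial]
  simp [transpose_mul, Matrix.mul_assoc]

/-- The Rayleigh bound: subtracting the least eigenvalue leaves a positive semidefinite matrix. -/
theorem Problem.eigen_mul_sq_le (M : Problem S d) {stat : S → ℝ} {w : ℝ}
    (hw : IsLeast (spectrum ℝ (M.Phiᵀ * Matrix.diagonal stat * M.Phi)) w)
    (u : EuclideanSpace ℝ (Fin d)) : w * ‖u‖ ^ 2 ≤ wdot stat (M.feat u) (M.feat u) := by
  set A := M.Phiᵀ * Matrix.diagonal stat * M.Phi with hA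
  have hps : (A - algebraMap ℝ _ w).PosSemidef := by
    rw [posSemidef_iff_isHermitian_and_spectrum_nonneg]
    refine ⟨(M.isHermitian_covariance stat).sub ?_, fun x hx => ?_⟩
    · rw [algebraMap_eq_diagonal]
      exact isHermitian_diagonal _
    · rw [← spectrum.sub_singleton_eq] at hx
      obtain ⟨y, hy, z, rfl, rfl⟩ := hx
      exact sub_nonneg.2 (hw.2 hy)
  have h1 := hps.re_dotProduct_nonneg (fun j => u j)
  rw [sub_mulVec, dotProduct_sub, Algebra.algebraMap_eq_smul_one, smul_mulVec, one_mulVec] at h1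
  have h2 := M.inner_covariance stat u
  simp only [star_trivial, RCLike.re_to_real, dotProduct_smul, smul_eq_mul] at h1
  rw [h2] at h1
  have h3 : (fun j => u j) ⬝ᵥ (fun j => u j) = ‖u‖ ^ 2 := by
    rw [EuclideanSpace.norm_sq_eq]
    simp [dotProduct, sq]
  rw [h3] at h1
  linarith

/-- For an eigenvector `u` of `w`, `w * ‖u‖ ^ 2` is the weighted square sum of `Φ u`, which is
nonzero by full column rank and positivity of `stat`. -/
theorem Problem.eigen_pos (M : Problem S d) {stat : S → ℝ} {w : ℝ} (hs : ∀ s, 0 < stat s)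
    (hr : LinearIndependent ℝ M.Phi.col)
    (hw : IsLeast (spectrum ℝ (M.Phiᵀ * Matrix.diagonal stat * M.Phi)) w) : 0 < w := by
  have h1 := hw.1
  rw [← spectrum_toLin', ← Module.End.hasEigenvalue_iff_mem_spectrum] at h1
  obtain ⟨u, hu⟩ := h1.exists_hasEigenvector
  have h2 := hu.apply_eq_smul
  rw [toLin'_apply] at h2
  have h3 := M.inner_covariance stat (WithLp.toLp 2 u)
  change u ⬝ᵥ (_ *ᵥ u) = _ at h3
  rw [h2, dotProduct_smul, smul_eq_mul] at h3
  have h4 : 0 < u ⬝ᵥ u := by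
    rw [← star_trivial u]
    exact dotProduct_star_self_pos_iff.2 hu.2
  have h5 : M.feat (WithLp.toLp 2 u) ≠ 0 := fun h => by
    rw [← M.Phi_mulVec] at h
    exact hu.2 ((mulVec_injective_iff.2 hr) (h.trans (mulVec_zero _).symm))
  obtain ⟨s, hs'⟩ := Function.ne_iff.1 h5
  have h6 : 0 < wdot stat (M.feat (WithLp.toLp 2 u)) (M.feat (WithLp.toLp 2 u)) :=
    Finset.sum_pos' (fun s _ => mul_nonneg (hs s).le (mul_self_nonneg _))
      ⟨s, Finset.mem_univ _, mul_pos (hs s) (mul_self_pos.2 hs')⟩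
  rw [← h3] at h6
  exact pos_of_mul_pos_left h6 h4.le

/-! ### The Bellman residual -/

/-- The expected temporal difference `R + γ P V - V` of a value function. -/
def Problem.resid (M : Problem S d) (γ : ℝ) (V : S → ℝ) : S → ℝ :=
  M.meanReward + γ • (M.P *ᵥ V) - V

theorem Problem.pow_mulVec_resid (M : Problem S d) (γ : ℝ) (V : S → ℝ) (t : ℕ) (s : S) :
    ((M.P ^ t) *ᵥ M.resid γ V) s
      = ((M.P ^ t) *ᵥ M.meanReward) s + γ * ((M.P ^ (t + 1)) *ᵥ V) s - ((M.P ^ t) *ᵥ V) s := by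
  simp [Problem.resid, mulVec_sub, mulVec_add, mulVec_smul, mulVec_mulVec, pow_succ]

theorem Problem.sum_resid (M : Problem S d) (γ : ℝ) (V : S → ℝ) (n : ℕ) (s : S) :
    ∑ t ∈ Finset.range n, γ ^ t * ((M.P ^ t) *ᵥ M.resid γ V) s
      = ∑ t ∈ Finset.range n, γ ^ t * ((M.P ^ t) *ᵥ M.meanReward) s
        + γ ^ n * ((M.P ^ n) *ᵥ V) s - V s := by
  induction n with
  | zero => simp
  | succ n ih =>
    rw [Finset.sum_range_succ, Finset.sum_range_succ, ih, M.pow_mulVec_resid]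
    ring

theorem exists_abs_le (f : S → ℝ) : ∃ c, ∀ s, |f s| ≤ c :=
  ⟨∑ s, |f s|, fun s => Finset.single_le_sum (f := fun s => |f s|)
    (fun _ _ => abs_nonneg _) (Finset.mem_univ s)⟩

theorem summable_geom_mul {x c : ℝ} {a : ℕ → ℝ} (h0 : 0 ≤ x) (h1 : x < 1)
    (ha : ∀ t, |a t| ≤ c) : Summable fun t => x ^ t * a t := by
  refine Summable.of_norm_bounded ((summable_geometric_of_lt_one h0 h1).mul_right c) fun t => ?_
  rw [Real.norm_eq_abs, abs_mul, abs_of_nonneg (pow_nonneg h0 t)]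
  exact mul_le_mul_of_nonneg_left (ha t) (pow_nonneg h0 t)

theorem tendsto_geom_mul {x c : ℝ} {a : ℕ → ℝ} (h0 : 0 ≤ x) (h1 : x < 1)
    (ha : ∀ t, |a t| ≤ c) : Tendsto (fun t => x ^ t * a t) atTop (𝓝 0) :=
  (summable_geom_mul h0 h1 ha).tendsto_atTop_zero

/-- The TD(λ) forward view equals the backward view: `T^λ V - V` is the `γλ`-discounted sum of the
expected temporal differences. -/
theorem Problem.hasSum_bellmanLam (M : Problem S d) (hP : M.P ∈ rowStochastic ℝ S) {γ lam : ℝ}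
    (hγ0 : 0 ≤ γ) (hγ1 : γ < 1) (hl0 : 0 ≤ lam) (hl1 : lam ≤ 1) (V : S → ℝ) (s : S) :
    HasSum (fun t : ℕ => (γ * lam) ^ t * ((M.P ^ t) *ᵥ M.resid γ V) s)
      (M.bellmanLam γ lam V s - V s) := by
  have hx0 : 0 ≤ γ * lam := mul_nonneg hγ0 hl0
  have hx1 : γ * lam < 1 := (mul_le_of_le_one_right hγ0 hl1).trans_lt hγ1
  have bd : ∀ f : S → ℝ, ∃ c, ∀ t : ℕ, |((M.P ^ t) *ᵥ f) s| ≤ c := fun f => by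
    obtain ⟨c, hc⟩ := exists_abs_le f
    exact ⟨c, fun t => abs_mulVec_le (pow_mem hP t) hc s⟩
  obtain ⟨cW, hcW⟩ := bd (M.resid γ V)
  obtain ⟨cR, hcR⟩ := bd M.meanReward
  obtain ⟨cV, hcV⟩ := bd V
  have hsum := summable_geom_mul hx0 hx1 hcW
  refine (hsum.hasSum_iff_tendsto_nat).2 ?_
  have hS : ∀ n, ∑ t ∈ Finset.range n, γ ^ t * ((M.P ^ t) *ᵥ M.resid γ V) s
      = ∑ t ∈ Finset.range n, γ ^ t * ((M.P ^ t) *ᵥ M.meanReward) s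
        + γ ^ n * ((M.P ^ n) *ᵥ V) s - V s := fun n => M.sum_resid γ V n s
  rcases eq_or_lt_of_le hl1 with rfl | hl1
  · simp only [mul_one, hS, Problem.bellmanLam, if_true, Problem.value]
    have h1 := (summable_geom_mul hγ0 hγ1 hcR).hasSum.tendsto_sum_nat
    have h2 := tendsto_geom_mul hγ0 hγ1 hcV
    simpa using (h1.add h2).sub_const (V s)
  · simp only [Problem.bellmanLam, if_neg hl1.ne]
    set a : ℕ → ℝ := fun t => ((M.P ^ t) *ᵥ M.resid γ V) s
    have hbound : ∀ n, |∑ t ∈ Finset.range n, γ ^ t * a t| ≤ (1 - γ)⁻¹ * cW := fun n => by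
      refine (Finset.abs_sum_le_sum_abs _ _).trans ?_
      have : ∀ t ∈ Finset.range n, |γ ^ t * a t| ≤ γ ^ t * cW := fun t _ => by
        rw [abs_mul, abs_of_nonneg (pow_nonneg hγ0 t)]
        exact mul_le_mul_of_nonneg_left (hcW t) (pow_nonneg hγ0 t)
      refine (Finset.sum_le_sum this).trans ?_
      rw [← Finset.sum_mul]
      refine mul_le_mul_of_nonneg_right ?_ ((abs_nonneg _).trans (hcW 0))
      rw [← tsum_geometric_of_lt_one hγ0 hγ1]
      exact (summable_geometric_of_lt_one hγ0 hγ1).sum_le_tsum _ fun t _ => pow_nonneg hγ0 t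
    have hstep : ∀ m, M.bellmanStep γ m V s
        = ∑ t ∈ Finset.range (m + 1), γ ^ t * a t + V s := fun m => by
      rw [Problem.bellmanStep, hS (m + 1)]
      ring
    -- Abel summation with exact remainder; `lam ^ n` times a bounded partial sum vanishes in the
    -- limit.
    have hpart : ∀ n, ∑ t ∈ Finset.range n, (γ * lam) ^ t * a t
        = (1 - lam) * ∑ m ∈ Finset.range n, lam ^ m * M.bellmanStep γ m V s
          + lam ^ n * ∑ t ∈ Finset.range n, γ ^ t * a t
          - (1 - lam) * (∑ m ∈ Finset.range n, lam ^ m) * V s := fun n => by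
      induction n with
      | zero => simp
      | succ n ih =>
        rw [Finset.sum_range_succ, ih, Finset.sum_range_succ _ n, hstep, Finset.sum_range_succ _ n,
          Finset.sum_range_succ _ n, mul_pow, pow_succ lam]
        ring
    have hb2 : ∀ m, |M.bellmanStep γ m V s| ≤ (1 - γ)⁻¹ * cW + |V s| := fun m => by
      rw [hstep]
      exact (abs_add_le _ _).trans (by linarith [hbound (m + 1)])
    have h1 := (summable_geom_mul hl0 hl1 hb2).hasSum.tendsto_sum_nat
    have h2 := tendsto_geom_mul hl0 hl1 hbound
    have h3 := (hasSum_geometric_of_lt_one hl0 hl1).tendsto_sum_nat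
    have h4 := ((h1.const_mul (1 - lam)).add h2).sub ((h3.const_mul (1 - lam)).mul_const (V s))
    rw [mul_inv_cancel₀ (by linarith), one_mul, add_zero] at h4
    exact h4.congr fun n => (hpart n).symm

/-- At the limiting point the discounted temporal differences are orthogonal to the features. -/
theorem Problem.hasSum_wdot_resid (M : Problem S d) (hP : M.P ∈ rowStochastic ℝ S)
    {stat : S → ℝ} {γ lam : ℝ} (hγ0 : 0 ≤ γ) (hγ1 : γ < 1) (hl0 : 0 ≤ lam) (hl1 : lam ≤ 1)
    {θs : EuclideanSpace ℝ (Fin d)} (h : M.gLam stat γ lam θs = 0)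
    (u : EuclideanSpace ℝ (Fin d)) :
    HasSum (fun t : ℕ => (γ * lam) ^ t
      * wdot stat (M.feat u) ((M.P ^ t) *ᵥ M.resid γ (M.feat θs))) 0 := by
  have h1 := M.inner_gLam stat γ lam u θs
  rw [h, dotProduct_zero] at h1
  rw [h1]
  have h2 := hasSum_sum (s := Finset.univ) fun s _ =>
    ((M.hasSum_bellmanLam hP hγ0 hγ1 hl0 hl1 (M.feat θs) s).mul_left (stat s * M.feat u s))
  have e1 : (fun t : ℕ => (γ * lam) ^ t
      * wdot stat (M.feat u) ((M.P ^ t) *ᵥ M.resid γ (M.feat θs)))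
      = fun t => ∑ s, stat s * M.feat u s
        * ((γ * lam) ^ t * ((M.P ^ t) *ᵥ M.resid γ (M.feat θs)) s) := funext fun t => by
    rw [wdot, Finset.mul_sum]
    exact Finset.sum_congr rfl fun s _ => by ring
  have e2 : wdot stat (M.feat u) (M.bellmanLam γ lam (M.feat θs) - M.feat θs)
      = ∑ s, stat s * M.feat u s * (M.bellmanLam γ lam (M.feat θs) s - M.feat θs s) :=
    Finset.sum_congr rfl fun s _ => by rw [Pi.sub_apply]; ring
  rw [e1, e2]
  exact h2

theorem Problem.abs_feat_le (M : Problem S d) (hφ : ∀ s, ‖M.φ s‖ ≤ 1)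
    {θ : EuclideanSpace ℝ (Fin d)} {R : ℝ} (hθ : ‖θ‖ ≤ R) (s : S) : |M.feat θ s| ≤ R :=
  (abs_real_inner_le_norm _ _).trans
    ((mul_le_mul (hφ s) hθ (norm_nonneg _) zero_le_one).trans_eq (one_mul R))

theorem Problem.abs_meanReward_le (M : Problem S d) (hP : M.P ∈ rowStochastic ℝ S) {B : ℝ}
    (hr : ∀ s s', |M.r s s'| ≤ B) (s : S) : |M.meanReward s| ≤ B := by
  calc |∑ s', M.P s s' * M.r s s'| ≤ ∑ s', |M.P s s' * M.r s s'| := Finset.abs_sum_le_sum_abs _ _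
    _ ≤ ∑ s', M.P s s' * B := Finset.sum_le_sum fun s' _ => by
        rw [abs_mul, abs_of_nonneg (nonneg_of_mem_rowStochastic hP)]
        exact mul_le_mul_of_nonneg_left (hr s s') (nonneg_of_mem_rowStochastic hP)
    _ = B := by rw [← Finset.sum_mul, sum_row_of_mem_rowStochastic hP, one_mul]

theorem Problem.abs_resid_le (M : Problem S d) (hP : M.P ∈ rowStochastic ℝ S) {B R γ : ℝ}
    (hγ0 : 0 ≤ γ) (hγ1 : γ ≤ 1) (hR : 0 ≤ R)
    (hr : ∀ s s', |M.r s s'| ≤ B) {V : S → ℝ} (hV : ∀ s, |V s| ≤ R) (s : S) :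
    |M.resid γ V s| ≤ B + 2 * R := by
  have h1 := abs_le.1 (M.abs_meanReward_le hP hr s)
  have h2 := abs_le.1 (abs_mulVec_le hP hV s)
  have h3 := abs_le.1 (hV s)
  have h4 : γ * (M.P *ᵥ V) s ≤ R := by nlinarith
  have h5 : -R ≤ γ * (M.P *ᵥ V) s := by nlinarith
  simp only [Problem.resid, Pi.sub_apply, Pi.add_apply, Pi.smul_apply, smul_eq_mul]
  rw [abs_le]
  constructor <;> linarith

theorem wdot_sub_right (stat f g g' : S → ℝ) :
    wdot stat f (g - g') = wdot stat f g - wdot stat f g' := by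
  simp [wdot, mul_sub, Finset.sum_sub_distrib]

theorem wdot_add_right (stat f g g' : S → ℝ) :
    wdot stat f (g + g') = wdot stat f g + wdot stat f g' := by
  simp [wdot, mul_add, Finset.sum_add_distrib]

theorem wdot_smul_right (stat f g : S → ℝ) (c : ℝ) :
    wdot stat f (c • g) = c * wdot stat f g := by
  simp only [wdot, Finset.mul_sum, Pi.smul_apply, smul_eq_mul]
  exact Finset.sum_congr rfl fun s _ => by ring

theorem sum_wdot_pow_ge {P : Matrix S S ℝ} {stat : S → ℝ} (hP : P ∈ rowStochastic ℝ S)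
    (h0 : ∀ s, 0 ≤ stat s) (h : stat ᵥ* P = stat) {γ x : ℝ} (hx : 0 ≤ x) (hxγ : x ≤ γ)
    (f : S → ℝ) (τ : ℕ) :
    (1 - γ) * (∑ j ∈ Finset.range τ, x ^ j) * wdot stat f f
      ≤ ∑ j ∈ Finset.range τ, x ^ j * wdot stat f ((P ^ j) *ᵥ (f - γ • (P *ᵥ f))) := by
  have h1 := discounted_corr_ge (q := fun j => wdot stat f ((P ^ j) *ᵥ f)) hx hxγ (fun j => by
    simpa using wdot_mulVec_le (pow_mem hP j) h0 (vecMul_pow_eq h j) f) τ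
  simp only [pow_zero, one_mulVec] at h1
  refine h1.trans_eq (Finset.sum_congr rfl fun j _ => ?_)
  rw [mulVec_sub, mulVec_smul, mulVec_mulVec, ← pow_succ, wdot_sub_right, wdot_smul_right]

theorem Problem.resid_eq (M : Problem S d) (γ : ℝ) (V : S → ℝ) :
    M.resid γ V = M.meanReward - (V - γ • (M.P *ᵥ V)) := by
  rw [Problem.resid]
  abel

theorem Problem.resid_eq_add (M : Problem S d) (γ : ℝ) (V V' : S → ℝ) :
    M.resid γ V = M.resid γ V' + ((V' - V) - γ • (M.P *ᵥ (V' - V))) := by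
  rw [M.resid_eq, M.resid_eq, mulVec_sub, smul_sub]
  abel

theorem Admissible.eigen_pos {M : Problem S d} {stat : S → ℝ} {B κ ρ w : ℝ}
    (hM : Admissible M stat B κ ρ w) : 0 < w :=
  M.eigen_pos hM.ergodic.pos hM.rank hM.eigen

theorem Admissible.B_nonneg [Nonempty S] {M : Problem S d} {stat : S → ℝ} {B κ ρ w : ℝ}
    (hM : Admissible M stat B κ ρ w) : 0 ≤ B :=
  let ⟨s⟩ := ‹Nonempty S›
  (abs_nonneg _).trans (hM.reward s s)

/-- The limiting point lies in the ball onto which the algorithm projects. -/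
theorem Admissible.norm_limit_le [Nonempty S] {M : Problem S d} {stat : S → ℝ} {B κ ρ w : ℝ}
    (hM : Admissible M stat B κ ρ w) {h : Hyper} (hh : h.Valid B w)
    {θs : EuclideanSpace ℝ (Fin d)} (hθ : M.gLam stat h.γ h.lam θs = 0) : ‖θs‖ ≤ h.R := by
  have hγ0 := hh.γ_pos
  have hγ1 := hh.γ_lt
  have hP := hM.stochastic
  have h0 : ∀ s, 0 ≤ stat s := fun s => (hM.ergodic.pos s).le
  have hst := hM.ergodic.vecMul_eq
  have h1 := hM.ergodic.sum_eq_one hP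
  have hB := hM.B_nonneg
  have hw := hM.eigen_pos
  have hx0 : 0 ≤ h.γ * h.lam := mul_nonneg hγ0.le hh.lam_nonneg
  have hxγ : h.γ * h.lam ≤ h.γ := mul_le_of_le_one_right hγ0.le hh.lam_le
  have hx1 : h.γ * h.lam < 1 := hxγ.trans_lt hγ1
  set x := h.γ * h.lam
  set f := M.feat θs
  have hT := (M.hasSum_wdot_resid hP hγ0.le hγ1 hh.lam_nonneg hh.lam_le hθ θs).tendsto_sum_nat
  have hσ := (hasSum_geometric_of_lt_one hx0 hx1).tendsto_sum_nat
  -- The limiting equation is tested with `u = θs` itself. The `f - γ P f` part of the residual is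
  -- coercive, and the reward part is at most `√(wdot stat f f) * B` by Cauchy–Schwarz.
  have key : ∀ τ, (1 - h.γ) * (∑ j ∈ Finset.range τ, x ^ j) * wdot stat f f
      ≤ (∑ j ∈ Finset.range τ, x ^ j) * (√(wdot stat f f) * B)
        - ∑ j ∈ Finset.range τ, x ^ j * wdot stat f ((M.P ^ j) *ᵥ M.resid h.γ f) := fun τ => by
    refine (sum_wdot_pow_ge hP h0 hst hx0 hxγ f τ).trans ?_
    rw [Finset.sum_mul, ← Finset.sum_sub_distrib]
    refine Finset.sum_le_sum fun j _ => ?_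
    rw [M.resid_eq, mulVec_sub _ M.meanReward, wdot_sub_right, mul_sub]
    have := wdot_le_sqrt_mul h0 h1 (f := f) hB
      (abs_mulVec_le (pow_mem hP j) (M.abs_meanReward_le hP hM.reward))
    have := mul_le_mul_of_nonneg_left this (pow_nonneg hx0 j)
    linarith
  have hlim := le_of_tendsto_of_tendsto' ((hσ.const_mul (1 - h.γ)).mul_const (wdot stat f f))
    ((hσ.mul_const (√(wdot stat f f) * B)).sub hT) key
  rw [sub_zero] at hlim
  have hF := wdot_self_nonneg h0 f
  set F := wdot stat f f
  have h2 : (1 - h.γ) * F ≤ √F * B := by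
    have h3 : 0 < (1 - x)⁻¹ := inv_pos.2 (by linarith)
    refine le_of_mul_le_mul_left ?_ h3
    linarith
  have h4 : (1 - h.γ) * √F ≤ B := by
    rcases (Real.sqrt_nonneg F).eq_or_lt with h5 | h5
    · rw [← h5]; simpa using hB
    · refine le_of_mul_le_mul_left ?_ h5
      nlinarith [Real.mul_self_sqrt hF]
  have h6 : √w * ‖θs‖ ≤ √F := by
    rw [← Real.sqrt_sq (norm_nonneg θs), ← Real.sqrt_mul hw.le]
    exact Real.sqrt_le_sqrt (M.eigen_mul_sq_le hM.eigen θs)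
  have hsw := Real.sqrt_pos.2 hw
  refine le_trans ?_ hh.R_ge
  have hg : 0 < 1 - h.γ := by linarith
  have hy0 : 0 < 1 - h.γ * (1 - h.lam) / (1 - h.γ * h.lam) := by
    rw [sub_pos, div_lt_one (by linarith)]
    linarith
  -- The estimate needs only the radius `B / (√w (1 - γ))`; the remaining factors of the assumed
  -- radius merely enlarge it.
  have hy1 : √(1 - h.γ * (1 - h.lam) / (1 - h.γ * h.lam)) ≤ 1 := by
    rw [Real.sqrt_le_one]
    have : 0 ≤ h.γ * (1 - h.lam) / (1 - h.γ * h.lam) :=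
      div_nonneg (mul_nonneg hγ0.le (by linarith [hh.lam_le])) (by linarith)
    linarith
  rw [le_div_iff₀ (by positivity)]
  have h7 : ‖θs‖ * (√w * (1 - h.γ)) ≤ B := by nlinarith
  have h8 : 0 ≤ ‖θs‖ * (√w * (1 - h.γ)) := by positivity
  nlinarith [Real.sqrt_nonneg (1 - h.γ * (1 - h.lam) / (1 - h.γ * h.lam))]

/-- The mean direction of the truncated eligibility trace points towards the limiting point. -/
theorem Admissible.drift_ge [Nonempty S] {M : Problem S d} {stat : S → ℝ} {B κ ρ w : ℝ}
    (hM : Admissible M stat B κ ρ w) {h : Hyper} (hh : h.Valid B w)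
    {θ θs : EuclideanSpace ℝ (Fin d)} (hs : M.gLam stat h.γ h.lam θs = 0) (hθ : ‖θ‖ ≤ h.R)
    {τ : ℕ} (hτ : 1 ≤ τ) :
    (1 - h.γ) * w * ‖θs - θ‖ ^ 2
        - 2 * h.R * (B + 2 * h.R) * (h.γ * h.lam) ^ τ / (1 - h.γ * h.lam)
      ≤ ∑ j ∈ Finset.range τ, (h.γ * h.lam) ^ j
          * wdot stat (M.feat (θs - θ)) ((M.P ^ j) *ᵥ M.resid h.γ (M.feat θ)) := by
  have hγ0 := hh.γ_pos
  have hγ1 := hh.γ_lt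
  have hP := hM.stochastic
  have h0 : ∀ s, 0 ≤ stat s := fun s => (hM.ergodic.pos s).le
  have h1 := hM.ergodic.sum_eq_one hP
  have hθs := hM.norm_limit_le hh hs
  have hx0 : 0 ≤ h.γ * h.lam := mul_nonneg hγ0.le hh.lam_nonneg
  have hxγ : h.γ * h.lam ≤ h.γ := mul_le_of_le_one_right hγ0.le hh.lam_le
  have hT := (M.hasSum_wdot_resid hP hγ0.le hγ1 hh.lam_nonneg hh.lam_le hs (θs - θ)).tendsto_sum_nat
  have hD := sum_wdot_pow_ge hP h0 hM.ergodic.vecMul_eq hx0 hxγ (M.feat (θs - θ)) τ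
  set x := h.γ * h.lam
  have hf : ∀ s, |M.feat (θs - θ) s| ≤ 2 * h.R := M.abs_feat_le hM.feature
    ((norm_sub_le _ _).trans (by linarith))
  have hbd : ∀ j, |wdot stat (M.feat (θs - θ)) ((M.P ^ j) *ᵥ M.resid h.γ (M.feat θs))|
      ≤ 2 * h.R * (B + 2 * h.R) := fun j => wdot_le_of_abs_le h0 h1 hf
    (abs_mulVec_le (pow_mem hP j) (M.abs_resid_le hP hγ0.le hγ1.le hh.R_pos.le hM.reward
      (M.abs_feat_le hM.feature hθs)))
  -- At `θs` the full series vanishes, so its partial sum is as small as the geometric tail.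
  have htail := dist_le_of_le_geometric_of_tendsto x (2 * h.R * (B + 2 * h.R))
    (hxγ.trans_lt hγ1) (fun n => by
      rw [dist_comm, Real.dist_eq, Finset.sum_range_succ, add_sub_cancel_left, abs_mul,
        abs_of_nonneg (pow_nonneg hx0 n), mul_comm]
      exact mul_le_mul_of_nonneg_right (hbd n) (pow_nonneg hx0 n)) hT τ
  rw [Real.dist_eq, sub_zero] at htail
  have hsplit : ∑ j ∈ Finset.range τ, x ^ j
          * wdot stat (M.feat (θs - θ)) ((M.P ^ j) *ᵥ M.resid h.γ (M.feat θ))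
      = ∑ j ∈ Finset.range τ, x ^ j
          * wdot stat (M.feat (θs - θ)) ((M.P ^ j) *ᵥ M.resid h.γ (M.feat θs))
        + ∑ j ∈ Finset.range τ, x ^ j * wdot stat (M.feat (θs - θ))
          ((M.P ^ j) *ᵥ (M.feat (θs - θ) - h.γ • (M.P *ᵥ M.feat (θs - θ)))) := by
    rw [← Finset.sum_add_distrib]
    refine Finset.sum_congr rfl fun j _ => ?_
    rw [M.resid_eq_add h.γ (M.feat θ) (M.feat θs), mulVec_add, wdot_add_right, mul_add,
      ← M.feat_sub]
  -- The coercivity constant is kept by the term `j = 0` alone; this is where `τ ≥ 1` enters.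
  have hσ : 1 ≤ ∑ j ∈ Finset.range τ, x ^ j := by
    rw [← Nat.sub_add_cancel hτ, Finset.sum_range_succ']
    simpa using Finset.sum_nonneg fun j _ => pow_nonneg hx0 (j + 1)
  have hF := M.eigen_mul_sq_le hM.eigen (θs - θ)
  have hF0 := wdot_self_nonneg h0 (M.feat (θs - θ))
  have hg : 0 < 1 - h.γ := by linarith
  have h2 : (1 - h.γ) * w * ‖θs - θ‖ ^ 2
      ≤ (1 - h.γ) * (∑ j ∈ Finset.range τ, x ^ j)
        * wdot stat (M.feat (θs - θ)) (M.feat (θs - θ)) := by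
    rw [mul_assoc, mul_assoc]
    refine mul_le_mul_of_nonneg_left (hF.trans ?_) hg.le
    exact le_mul_of_one_le_left hF0 hσ
  rw [hsplit]
  linarith [(abs_le.1 htail).1]

/-! ### The Markov property for functions of the path -/

theorem integral_comp_fintype {Ω T : Type*} [MeasurableSpace Ω] [Fintype T] [MeasurableSpace T]
    [MeasurableSingletonClass T] (μ : Measure Ω) [IsFiniteMeasure μ] {Y : Ω → T}
    (hY : Measurable Y) (f : T → ℝ) : ∫ ω, f (Y ω) ∂μ = ∑ t, μ.real (Y ⁻¹' {t}) * f t := by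
  rw [← integral_map hY.aemeasurable (Measurable.of_discrete).aestronglyMeasurable,
    integral_fintype .of_finite]
  refine Finset.sum_congr rfl fun t _ => ?_
  rw [map_measureReal_apply hY (measurableSet_singleton t), smul_eq_mul]

/-- The path that follows `p` and then stays where it is. -/
def extendPath {n : ℕ} (p : Fin (n + 1) → S) (i : ℕ) : S := p ⟨min i n, by omega⟩

theorem extendPath_restrict {n i : ℕ} (x : ℕ → S) (hi : i ≤ n) :
    extendPath (fun i : Fin (n + 1) => x i) i = x i := by
  simp [extendPath, hi]

section Paths

variable [MeasurableSpace S] [MeasurableSingletonClass S] {Ω : Type*} [MeasurableSpace Ω]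
  {μ : Measure Ω} {X : ℕ → Ω → S}

theorem measurable_of_dependsOn (hX : ∀ k, Measurable (X k)) {n : ℕ} {β : Type*}
    [MeasurableSpace β] {F : (ℕ → S) → β} (hF : DependsOn F (Set.Iic n)) :
    Measurable fun ω => F fun i => X i ω := by
  have h1 : (fun ω => F fun i => X i ω)
      = (fun p : Fin (n + 1) → S => F (extendPath p)) ∘ fun ω (i : Fin (n + 1)) => X i ω :=
    funext fun ω => hF fun i hi => (extendPath_restrict (fun i => X i ω) hi).symm
  rw [h1]
  exact Measurable.of_discrete.comp (measurable_pi_lambda _ fun i => hX i)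

theorem integrable_of_dependsOn [IsFiniteMeasure μ] (hX : ∀ k, Measurable (X k)) {n : ℕ}
    {F : (ℕ → S) → ℝ} (hF : DependsOn F (Set.Iic n)) : Integrable (fun ω => F fun i => X i ω) μ := by
  have h1 : ∀ x, ‖F x‖ ≤ ∑ p : Fin (n + 1) → S, ‖F (extendPath p)‖ := fun x => by
    have h2 : F x = F (extendPath fun i : Fin (n + 1) => x i) :=
      hF fun i hi => (extendPath_restrict x hi).symm
    rw [h2]
    exact Finset.single_le_sum (f := fun p : Fin (n + 1) → S => ‖F (extendPath p)‖)
      (fun _ _ => norm_nonneg _) (Finset.mem_univ _)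
  exact Integrable.of_bound (measurable_of_dependsOn hX hF).aestronglyMeasurable _
    (Eventually.of_forall fun ω => h1 _)

/-- The Markov property without conditional expectations: both sides are finite sums over initial
paths `p`, compared term by term by the defining identity for `p` prolonged by `y`. -/
theorem IsMarkovChain.integral_succ [IsProbabilityMeasure μ] {P : Matrix S S ℝ}
    (hX : IsMarkovChain μ P X) {n : ℕ} {F : (ℕ → S) → S → ℝ} (hF : DependsOn F (Set.Iic n)) :
    ∫ ω, F (fun i => X i ω) (X (n + 1) ω) ∂μ
      = ∫ ω, (P *ᵥ F fun i => X i ω) (X n ω) ∂μ := by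
  have hres : ∀ ω, F (fun i => X i ω) = F (extendPath fun i : Fin (n + 1) => X i ω) := fun ω =>
    hF fun i hi => (extendPath_restrict (fun i => X i ω) hi).symm
  have hY : Measurable fun ω (i : Fin (n + 1)) => X i ω :=
    measurable_pi_lambda _ fun i => hX.measurable i
  have h1 := integral_comp_fintype μ (hY.prodMk (hX.measurable (n + 1)))
    fun p : (Fin (n + 1) → S) × S => F (extendPath p.1) p.2
  have h2 := integral_comp_fintype μ hY
    fun p : Fin (n + 1) → S => (P *ᵥ F (extendPath p)) (p (Fin.last n))
  simp only [← hres] at h1 h2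
  simp only [Fin.val_last] at h2
  rw [h1, h2, Fintype.sum_prod_type]
  refine Finset.sum_congr rfl fun p _ => ?_
  rw [mulVec, dotProduct, Finset.mul_sum]
  refine Finset.sum_congr rfl fun y _ => ?_
  have h3 := hX.markov n (Function.update (extendPath p) (n + 1) y)
  have e0 : ∀ i ≤ n, Function.update (extendPath p) (n + 1) y i = extendPath p i := fun i hi =>
    Function.update_of_ne (by omega) _ _
  have e1 : {ω | ∀ i ≤ n, X i ω = Function.update (extendPath p) (n + 1) y i}
      = (fun ω (i : Fin (n + 1)) => X i ω) ⁻¹' {p} := by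
    ext ω
    simp only [Set.mem_ofPred_eq, Set.mem_preimage, Set.mem_singleton_iff, funext_iff]
    constructor
    · intro h i
      rw [h i (by omega), e0 i (by omega), extendPath]
      congr 1
      ext
      simp
      omega
    · intro h i hi
      rw [e0 i hi, extendPath, ← h]
      simp [hi]
  have e2 : {ω | ∀ i ≤ n + 1, X i ω = Function.update (extendPath p) (n + 1) y i}
      = (fun ω => (fun i : Fin (n + 1) => X i ω, X (n + 1) ω)) ⁻¹' {(p, y)} := by
    have : {ω | ∀ i ≤ n + 1, X i ω = Function.update (extendPath p) (n + 1) y i}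
        = {ω | ∀ i ≤ n, X i ω = Function.update (extendPath p) (n + 1) y i}
          ∩ {ω | X (n + 1) ω = y} := by
      ext ω
      simp only [Set.mem_ofPred_eq, Set.mem_inter_iff, Nat.le_succ_iff, or_imp, forall_and,
        forall_eq, Function.update_self]
    rw [this, e1]
    ext ω
    simp [Prod.ext_iff]
  rw [e1, e2, Function.update_self, e0 n le_rfl] at h3
  have e3 : extendPath p n = p (Fin.last n) := by simp [extendPath, Fin.last]
  rw [h3, e3]
  ring

theorem IsMarkovChain.integral_add [IsProbabilityMeasure μ] {P : Matrix S S ℝ}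
    (hX : IsMarkovChain μ P X) {n : ℕ} (m : ℕ) {F : (ℕ → S) → S → ℝ}
    (hF : DependsOn F (Set.Iic n)) :
    ∫ ω, F (fun i => X i ω) (X (n + m) ω) ∂μ
      = ∫ ω, ((P ^ m) *ᵥ F fun i => X i ω) (X n ω) ∂μ := by
  induction m generalizing F with
  | zero => simp
  | succ m ih =>
    rw [← add_assoc, hX.integral_succ (n := n + m)
      (fun x y h => hF fun i hi => h i (le_trans hi (Nat.le_add_right _ _)))]
    have h1 : DependsOn (fun x => P *ᵥ F x) (Set.Iic n) := fun x y h => by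
      change P *ᵥ F x = P *ᵥ F y
      rw [hF h]
    rw [ih h1]
    simp only [mulVec_mulVec, ← pow_succ]

/-- A function of the first states and of three later states, of which the last two are
consecutive, has nearly the mean that it would have if the first of the three was stationary. -/
theorem IsMarkovChain.abs_integral_sub_le [IsProbabilityMeasure μ] {P : Matrix S S ℝ}
    {stat : S → ℝ} {κ ρ : ℝ} (hP : P ∈ rowStochastic ℝ S) (hs : GeomErgodic P stat κ ρ)
    (hX : IsMarkovChain μ P X) {n : ℕ} (a j : ℕ) {T : (ℕ → S) → S → S → S → ℝ} {H : ℝ}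
    (hT : DependsOn T (Set.Iic n)) (hH : ∀ x y y' y'', |T x y y' y''| ≤ H) :
    |∫ ω, T (fun i => X i ω) (X (n + a) ω) (X (n + a + j) ω) (X (n + a + j + 1) ω) ∂μ
      - ∫ ω, ∑ y, stat y
        * ((P ^ j) *ᵥ fun y' => (P *ᵥ T (fun i => X i ω) y y') y') y ∂μ| ≤ κ * ρ ^ a * H := by
  have hmono : ∀ {β : Type _} {F : (ℕ → S) → β} {k l : ℕ}, k ≤ l → DependsOn F (Set.Iic k) →
      DependsOn F (Set.Iic l) := fun hkl hF x y h => hF fun i hi => h i (le_trans hi hkl)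
  -- The states are averaged out from the latest backwards, the earlier ones being frozen in `F`.
  -- What remains is `P ^ a` against `stat`, applied to the bounded function `Q` of the past.
  have h1 := hX.integral_succ (n := n + a + j)
    (F := fun x y'' => T x (x (n + a)) (x (n + a + j)) y'') (fun x y h => by
      have e : T x = T y := hmono (by omega) hT h
      simp only [e, h (n + a) (Set.mem_Iic.2 (by omega)), h (n + a + j) (Set.mem_Iic.2 le_rfl)])
  have h2 := hX.integral_add (n := n + a) j
    (F := fun x y' => (P *ᵥ T x (x (n + a)) y') y') (fun x y h => by
      have e : T x = T y := hmono (by omega) hT h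
      simp only [e, h (n + a) (Set.mem_Iic.2 (by omega))])
  have h3 := hX.integral_add (n := n) a
    (F := fun x y => ((P ^ j) *ᵥ fun y' => (P *ᵥ T x y y') y') y) (fun x y h => by
      have e : T x = T y := hT h
      simp only [e])
  set Q : (ℕ → S) → S → ℝ := fun x y => ((P ^ j) *ᵥ fun y' => (P *ᵥ T x y y') y') y with hQ
  have hQd : DependsOn Q (Set.Iic n) := fun x y h => by
    have e : T x = T y := hT h
    simp only [hQ, e]
  have hQH : ∀ x y, |Q x y| ≤ H := fun x y =>
    abs_mulVec_le (pow_mem hP j) (fun y' => abs_mulVec_le hP (hH x y y') y') y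
  rw [h1, h2, h3]
  have i1 : Integrable (fun ω => ((P ^ a) *ᵥ Q fun i => X i ω) (X n ω)) μ :=
    integrable_of_dependsOn hX.measurable (n := n)
      (F := fun x => ((P ^ a) *ᵥ Q x) (x n)) (fun x y h => by
        have e : Q x = Q y := hQd h
        simp only [e, h n (Set.mem_Iic.2 le_rfl)])
  have i2 : Integrable (fun ω => ∑ y, stat y * Q (fun i => X i ω) y) μ :=
    integrable_of_dependsOn hX.measurable (n := n)
      (F := fun x => ∑ y, stat y * Q x y) (fun x y h => by
        have e : Q x = Q y := hQd h
        simp only [e])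
  rw [← integral_sub i1 i2]
  have hpt : ∀ ω, ‖((P ^ a) *ᵥ Q fun i => X i ω) (X n ω)
      - ∑ y, stat y * Q (fun i => X i ω) y‖ ≤ κ * ρ ^ a * H := fun ω => by
    rw [mulVec, dotProduct, ← Finset.sum_sub_distrib, Real.norm_eq_abs]
    have hH0 : 0 ≤ H := (abs_nonneg _).trans (hQH (fun i => X i ω) (X n ω))
    calc _ ≤ ∑ y, |(P ^ a) (X n ω) y * Q (fun i => X i ω) y - stat y * Q (fun i => X i ω) y| :=
          Finset.abs_sum_le_sum_abs _ _
      _ ≤ ∑ y, |(P ^ a) (X n ω) y - stat y| * H := Finset.sum_le_sum fun y _ => by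
          rw [← sub_mul, abs_mul]
          exact mul_le_mul_of_nonneg_left (hQH _ y) (abs_nonneg _)
      _ ≤ _ := by
          rw [← Finset.sum_mul]
          exact mul_le_mul_of_nonneg_right (hs.bound a (X n ω)) hH0
  simpa using norm_integral_le_of_norm_le_const (μ := μ) (Eventually.of_forall hpt)

end Paths

/-! ### The algorithm along a path -/

theorem norm_projBall_le {R : ℝ} (hR : 0 ≤ R) (a : EuclideanSpace ℝ (Fin d)) :
    ‖projBall R a‖ ≤ R := by
  unfold projBall
  split_ifs with h
  · exact h
  · have ha : 0 < ‖a‖ := hR.trans_lt (not_le.1 h)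
    rw [norm_smul, Real.norm_of_nonneg (div_nonneg hR ha.le), div_mul_cancel₀ _ ha.ne']

/-- Only comparison with points of the ball is needed, and expanding the squares then suffices. -/
theorem norm_projBall_sub_le {R : ℝ} (a : EuclideanSpace ℝ (Fin d))
    {y : EuclideanSpace ℝ (Fin d)} (hy : ‖y‖ ≤ R) : ‖projBall R a - y‖ ≤ ‖a - y‖ := by
  unfold projBall
  split_ifs with h
  · exact le_rfl
  · have hR : 0 ≤ R := (norm_nonneg _).trans hy
    rw [not_le] at h
    have ha : 0 < ‖a‖ := hR.trans_lt h
    refine abs_le_of_sq_le_sq' ?_ (norm_nonneg _) |>.2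
    have ht : R / ‖a‖ * ‖a‖ = R := div_mul_cancel₀ _ ha.ne'
    have ht1 : R / ‖a‖ ≤ 1 := (div_le_one ha).2 h.le
    have hin : inner ℝ a y ≤ ‖a‖ * R :=
      (real_inner_le_norm _ _).trans (mul_le_mul_of_nonneg_left hy ha.le)
    rw [norm_sub_sq_real, norm_sub_sq_real, norm_smul, real_inner_smul_left,
      Real.norm_of_nonneg (div_nonneg hR ha.le), ht]
    have h1 := mul_le_mul_of_nonneg_left hin (sub_nonneg.2 ht1)
    have h2 : (1 - R / ‖a‖) * (‖a‖ * R) = ‖a‖ * R - R * R := by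
      rw [sub_mul, one_mul, ← mul_assoc, ht]
    nlinarith [sq_nonneg (‖a‖ - R)]

/-- The memory after `k` iterations when the observed states are `y 0, y 1, …`. -/
def Problem.pathRun (M : Problem S d) (h : Hyper) (θ₁ : EuclideanSpace ℝ (Fin d)) (k : ℕ)
    (y : ℕ → S) : Memory d := M.run h θ₁ (fun i => y (i - 1)) k

theorem Problem.pathRun_succ (M : Problem S d) (h : Hyper) (θ₁ : EuclideanSpace ℝ (Fin d))
    (k : ℕ) (y : ℕ → S) :
    M.pathRun h θ₁ (k + 1) y = M.step h (y k) (y (k + 1)) (M.pathRun h θ₁ k y) := rfl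

/-- The algorithm never reads the state with index `0`, so the truncated `i - 1` in `pathRun` is
harmless. -/
theorem Problem.run_eq_pathRun (M : Problem S d) (h : Hyper) (θ₁ : EuclideanSpace ℝ (Fin d))
    (k : ℕ) (x : ℕ → S) : M.run h θ₁ x k = M.pathRun h θ₁ k fun i => x (i + 1) := by
  induction k with
  | zero => rfl
  | succ k ih => rw [Problem.run, ih, M.pathRun_succ]

/-- This places the memory in the past at time `k`, as the Markov property requires. -/
theorem Problem.dependsOn_pathRun (M : Problem S d) (h : Hyper)
    (θ₁ : EuclideanSpace ℝ (Fin d)) (k : ℕ) : DependsOn (M.pathRun h θ₁ k) (Set.Iic k) := by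
  induction k with
  | zero => exact fun _ _ _ => rfl
  | succ k ih =>
    intro x y hxy
    rw [M.pathRun_succ, M.pathRun_succ, hxy k (Set.mem_Iic.2 (Nat.le_succ k)),
      hxy (k + 1) (Set.mem_Iic.2 le_rfl),
      ih fun i hi => hxy i (Set.mem_Iic.2 (le_trans hi (Nat.le_succ k)))]

/-- The semi-gradient used in iteration `k + 1`. -/
def Problem.pathGrad (M : Problem S d) (h : Hyper) (θ₁ : EuclideanSpace ℝ (Fin d)) (y : ℕ → S)
    (k : ℕ) : EuclideanSpace ℝ (Fin d) :=
  M.semigrad h.γ (M.pathRun h θ₁ k y).theta (y k) (y (k + 1)) (M.pathRun h θ₁ (k + 1) y).z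

/-- The temporal difference of `θ` for the transition `s → s'`. -/
def Problem.tdError (M : Problem S d) (γ : ℝ) (θ : EuclideanSpace ℝ (Fin d)) (s s' : S) : ℝ :=
  M.r s s' + γ * M.feat θ s' - M.feat θ s

/-- The eligibility trace restricted to the last `τ` states. -/
def Problem.trace (M : Problem S d) (x : ℝ) (τ : ℕ) (y : ℕ → S) (k : ℕ) :
    EuclideanSpace ℝ (Fin d) :=
  ∑ j ∈ Finset.range τ, x ^ j • M.φ (y (k - j))

/-- The bound `(B + 2 R) / (1 - γ)` of the semi-gradients. -/
def gradBound (h : Hyper) (B : ℝ) : ℝ := (B + 2 * h.R) / (1 - h.γ)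

section Bounds

variable {M : Problem S d} {h : Hyper} {B w : ℝ} {θ₁ : EuclideanSpace ℝ (Fin d)}

theorem abs_tdError_le (hh : h.Valid B w) (hr : ∀ s s', |M.r s s'| ≤ B)
    (hφ : ∀ s, ‖M.φ s‖ ≤ 1) {θ : EuclideanSpace ℝ (Fin d)} (hθ : ‖θ‖ ≤ h.R) (s s' : S) :
    |M.tdError h.γ θ s s'| ≤ B + 2 * h.R := by
  have h1 := abs_le.1 (hr s s')
  have h2 := abs_le.1 (M.abs_feat_le hφ hθ s)
  have h3 := abs_le.1 (M.abs_feat_le hφ hθ s')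
  have h4 : h.γ * M.feat θ s' ≤ h.R := by nlinarith [hh.γ_pos, hh.γ_lt, hh.R_pos]
  have h5 : -h.R ≤ h.γ * M.feat θ s' := by nlinarith [hh.γ_pos, hh.γ_lt, hh.R_pos]
  rw [Problem.tdError, abs_le]
  constructor <;> linarith

theorem abs_tdError_sub_le (hh : h.Valid B w) (hφ : ∀ s, ‖M.φ s‖ ≤ 1)
    (θ θ' : EuclideanSpace ℝ (Fin d)) (s s' : S) :
    |M.tdError h.γ θ s s' - M.tdError h.γ θ' s s'| ≤ 2 * ‖θ' - θ‖ := by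
  have e : M.tdError h.γ θ s s' - M.tdError h.γ θ' s s'
      = M.feat (θ' - θ) s - h.γ * M.feat (θ' - θ) s' := by
    simp only [Problem.tdError, M.feat_sub, Pi.sub_apply]
    ring
  have h2 := abs_le.1 (M.abs_feat_le hφ (le_refl ‖θ' - θ‖) s)
  have h3 := abs_le.1 (M.abs_feat_le hφ (le_refl ‖θ' - θ‖) s')
  have hn := norm_nonneg (θ' - θ)
  have h4 : h.γ * M.feat (θ' - θ) s' ≤ ‖θ' - θ‖ := by nlinarith [hh.γ_pos, hh.γ_lt]
  have h5 : -‖θ' - θ‖ ≤ h.γ * M.feat (θ' - θ) s' := by nlinarith [hh.γ_pos, hh.γ_lt]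
  rw [e, abs_le]
  constructor <;> linarith

theorem Hyper.Valid.decay_nonneg (hh : h.Valid B w) : 0 ≤ h.γ * h.lam :=
  mul_nonneg hh.γ_pos.le hh.lam_nonneg

theorem Hyper.Valid.decay_le (hh : h.Valid B w) : h.γ * h.lam ≤ h.γ :=
  mul_le_of_le_one_right hh.γ_pos.le hh.lam_le

theorem Hyper.Valid.sum_decay_le (hh : h.Valid B w) (τ : ℕ) :
    ∑ j ∈ Finset.range τ, (h.γ * h.lam) ^ j ≤ (1 - h.γ)⁻¹ := by
  refine (Finset.sum_le_sum fun j _ => pow_le_pow_left₀ hh.decay_nonneg hh.decay_le j).trans ?_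
  rw [← tsum_geometric_of_lt_one hh.γ_pos.le hh.γ_lt]
  exact (summable_geometric_of_lt_one hh.γ_pos.le hh.γ_lt).sum_le_tsum _
    fun t _ => pow_nonneg hh.γ_pos.le t

theorem norm_trace_le (hh : h.Valid B w) (hφ : ∀ s, ‖M.φ s‖ ≤ 1) (τ : ℕ) (y : ℕ → S) (k : ℕ) :
    ‖M.trace (h.γ * h.lam) τ y k‖ ≤ (1 - h.γ)⁻¹ := by
  refine (norm_sum_le _ _).trans (le_trans (Finset.sum_le_sum fun j _ => ?_) (hh.sum_decay_le τ))
  rw [norm_smul, Real.norm_of_nonneg (pow_nonneg hh.decay_nonneg j)]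
  exact mul_le_of_le_one_right (pow_nonneg hh.decay_nonneg j) (hφ _)

theorem pathRun_z_succ (y : ℕ → S) (k : ℕ) :
    (M.pathRun h θ₁ (k + 1) y).z = (h.γ * h.lam) • (M.pathRun h θ₁ k y).z + M.φ (y k) := rfl

theorem pathRun_z_eq (y : ℕ → S) (k : ℕ) {τ : ℕ} (hτ : τ ≤ k + 1) :
    (M.pathRun h θ₁ (k + 1) y).z = M.trace (h.γ * h.lam) τ y k
      + (h.γ * h.lam) ^ τ • (M.pathRun h θ₁ (k + 1 - τ) y).z := by
  induction τ with
  | zero => simp [Problem.trace]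
  | succ τ ih =>
    rw [ih (by omega), Problem.trace, Problem.trace, Finset.sum_range_succ,
      show k + 1 - τ = (k - τ) + 1 by omega, pathRun_z_succ,
      show k + 1 - (τ + 1) = k - τ by omega, smul_add, smul_smul, pow_succ]
    abel

theorem norm_pathRun_z_le (hh : h.Valid B w) (hφ : ∀ s, ‖M.φ s‖ ≤ 1) (y : ℕ → S) (k : ℕ) :
    ‖(M.pathRun h θ₁ k y).z‖ ≤ (1 - h.γ)⁻¹ := by
  rcases k with _ | k
  · have : 0 < 1 - h.γ := by linarith [hh.γ_lt]
    change ‖(0 : EuclideanSpace ℝ (Fin d))‖ ≤ _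
    rw [norm_zero]
    positivity
  · rw [pathRun_z_eq y k (le_refl _), Nat.sub_self]
    change ‖_ + _ • (0 : EuclideanSpace ℝ (Fin d))‖ ≤ _
    rw [smul_zero, add_zero]
    exact norm_trace_le hh hφ _ y k

theorem norm_pathRun_theta_le (hh : h.Valid B w) (h1 : ‖θ₁‖ ≤ h.R) (y : ℕ → S) (k : ℕ) :
    ‖(M.pathRun h θ₁ k y).theta‖ ≤ h.R := by
  rcases k with _ | k
  · exact h1
  · exact norm_projBall_le hh.R_pos.le _

theorem norm_semigrad_le (hh : h.Valid B w) (hr : ∀ s s', |M.r s s'| ≤ B)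
    (hφ : ∀ s, ‖M.φ s‖ ≤ 1) {θ z : EuclideanSpace ℝ (Fin d)} (hθ : ‖θ‖ ≤ h.R)
    (hz : ‖z‖ ≤ (1 - h.γ)⁻¹) (s s' : S) : ‖M.semigrad h.γ θ s s' z‖ ≤ gradBound h B := by
  change ‖M.tdError h.γ θ s s' • z‖ ≤ _
  have h1 := abs_tdError_le hh hr hφ hθ s s'
  rw [norm_smul, gradBound, div_eq_mul_inv]
  exact mul_le_mul h1 hz (norm_nonneg _) ((abs_nonneg _).trans h1)

theorem adaptiveMomentum_pathRun (hh : h.Valid B w) (hr : ∀ s s', |M.r s s'| ≤ B)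
    (hφ : ∀ s, ‖M.φ s‖ ≤ 1) (h1 : ‖θ₁‖ ≤ h.R) (y : ℕ → S) :
    AdaptiveMomentum (fun k => (M.pathRun h θ₁ k y).theta) (fun k => (M.pathRun h θ₁ k y).m)
      (M.pathGrad h θ₁ y) (fun k => (M.pathRun h θ₁ k y).v) h.η h.δ h.β h.R (gradBound h B) where
  η_pos := hh.η_pos
  δ_pos := hh.δ_pos
  β_nonneg := hh.β_nonneg
  β_lt := hh.β_lt
  v_zero := rfl
  v_succ _ := rfl
  m_zero := rfl
  m_succ _ := rfl
  theta_le := norm_pathRun_theta_le hh h1 y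
  grad_le k := norm_semigrad_le hh hr hφ (norm_pathRun_theta_le hh h1 y k)
    (norm_pathRun_z_le hh hφ y (k + 1)) _ _
  contract _ _ hz := norm_projBall_sub_le _ hz

/-- The semi-gradient for a transition of the present with the parameter of the past. -/
def Problem.lagGrad (M : Problem S d) (h : Hyper) (θ₁ : EuclideanSpace ℝ (Fin d)) (τ : ℕ)
    (y : ℕ → S) (n : ℕ) : EuclideanSpace ℝ (Fin d) :=
  M.semigrad h.γ (M.pathRun h θ₁ n y).theta (y (n + 2 * τ)) (y (n + 2 * τ + 1))
    (M.trace (h.γ * h.lam) τ y (n + 2 * τ))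

/-- There are two discrepancies: the stale parameter, in which the temporal difference is
`2`-Lipschitz, and the forgotten part of the trace, damped by `(γ * lam) ^ τ`. -/
theorem norm_lagGrad_sub_le (hh : h.Valid B w) (hr : ∀ s s', |M.r s s'| ≤ B)
    (hφ : ∀ s, ‖M.φ s‖ ≤ 1) (h1 : ‖θ₁‖ ≤ h.R) (τ : ℕ) (y : ℕ → S) (n : ℕ) :
    ‖M.lagGrad h θ₁ τ y n - M.pathGrad h θ₁ y (n + 2 * τ)‖
      ≤ 2 / (1 - h.γ)
          * ‖(M.pathRun h θ₁ (n + 2 * τ) y).theta - (M.pathRun h θ₁ n y).theta‖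
        + gradBound h B * h.γ ^ τ := by
  set θ := (M.pathRun h θ₁ n y).theta
  set θ' := (M.pathRun h θ₁ (n + 2 * τ) y).theta
  set s := y (n + 2 * τ)
  set s' := y (n + 2 * τ + 1)
  have hz := pathRun_z_eq (M := M) (h := h) (θ₁ := θ₁) y (n + 2 * τ) (τ := τ) (by omega)
  have hz' := norm_pathRun_z_le (M := M) (θ₁ := θ₁) hh hφ y (n + 2 * τ + 1)
  set z' := (M.pathRun h θ₁ (n + 2 * τ + 1 - τ) y).z
  have hzn : ‖z'‖ ≤ (1 - h.γ)⁻¹ := norm_pathRun_z_le hh hφ y _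
  set z := (M.pathRun h θ₁ (n + 2 * τ + 1) y).z
  set t := M.trace (h.γ * h.lam) τ y (n + 2 * τ)
  have e : M.lagGrad h θ₁ τ y n - M.pathGrad h θ₁ y (n + 2 * τ)
      = (M.tdError h.γ θ s s' - M.tdError h.γ θ' s s') • z
        - (M.tdError h.γ θ s s' * (h.γ * h.lam) ^ τ) • z' := by
    change M.tdError h.γ θ s s' • t - M.tdError h.γ θ' s s' • z = _
    rw [eq_sub_of_add_eq hz.symm]
    module
  have b1 := abs_tdError_le hh hr hφ (norm_pathRun_theta_le (M := M) hh h1 y n) s s'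
  have b2 := abs_tdError_sub_le (M := M) hh hφ θ θ' s s'
  have hp := pow_le_pow_left₀ hh.decay_nonneg hh.decay_le τ
  have hg : 0 < 1 - h.γ := by linarith [hh.γ_lt]
  rw [e]
  refine (norm_sub_le _ _).trans ?_
  rw [norm_smul, norm_smul, Real.norm_eq_abs, Real.norm_eq_abs, abs_mul,
    abs_of_nonneg (pow_nonneg hh.decay_nonneg τ), gradBound]
  refine add_le_add ?_ ?_
  · calc _ ≤ 2 * ‖θ' - θ‖ * (1 - h.γ)⁻¹ :=
          mul_le_mul b2 hz' (norm_nonneg _) (by positivity)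
      _ = _ := by rw [div_eq_mul_inv]; ring
  · have hBR : 0 ≤ B + 2 * h.R := (abs_nonneg _).trans b1
    calc _ ≤ (B + 2 * h.R) * h.γ ^ τ * (1 - h.γ)⁻¹ :=
          mul_le_mul (mul_le_mul b1 hp (pow_nonneg hh.decay_nonneg τ) hBR) hzn (norm_nonneg _)
            (mul_nonneg hBR (pow_nonneg hh.γ_pos.le τ))
      _ = _ := by rw [div_eq_mul_inv]; ring

/-- The constant of the transient in the error bound. -/
def transientConst (h : Hyper) (B w : ℝ) : ℝ :=
  lagConst h.η h.δ h.β h.R (gradBound h B) (2 / (1 - h.γ)) ((1 - h.γ) * w)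

/-- The absorbed multiple is chosen as `μ = (1 - γ) * w`, the strength of the drift, so that half of
the drift survives. -/
theorem sum_lagGrad_le (hh : h.Valid B w) (hw : 0 < w) (hr : ∀ s s', |M.r s s'| ≤ B)
    (hφ : ∀ s, ‖M.φ s‖ ≤ 1) (h1 : ‖θ₁‖ ≤ h.R) {θs : EuclideanSpace ℝ (Fin d)}
    (hθ : ‖θs‖ ≤ h.R) (τ N : ℕ) (y : ℕ → S) :
    ∑ n ∈ Finset.range N, 1 / √((M.pathRun h θ₁ n y).v + h.δ)
        * inner ℝ (θs - (M.pathRun h θ₁ n y).theta) (M.lagGrad h θ₁ τ y n)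
      ≤ (1 - h.γ) * w / 2 * ∑ n ∈ Finset.range N, 1 / √((M.pathRun h θ₁ n y).v + h.δ)
          * ‖θs - (M.pathRun h θ₁ n y).theta‖ ^ 2
        + transientConst h B w * (2 * τ + 1) ^ 2
          * (1 + Real.log (1 + gradBound h B ^ 2 * (N + 2 * τ : ℕ) / h.δ))
        + N * (2 * h.R * (gradBound h B * h.γ ^ τ) / √h.δ) := by
  have hg : 0 < 1 - h.γ := by linarith [hh.γ_lt]
  have H := adaptiveMomentum_pathRun hh hr hφ h1 y
  have := H.sum_lagged_le hθ (f := M.lagGrad h θ₁ τ y) (l := 2 * τ) (μ := (1 - h.γ) * w)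
    (mul_pos hg hw) (L := 2 / (1 - h.γ)) (by positivity)
    (e := gradBound h B * h.γ ^ τ) (mul_nonneg H.G_nonneg (pow_nonneg hh.γ_pos.le τ))
    (fun n => norm_semigrad_le hh hr hφ (norm_pathRun_theta_le hh h1 y n)
      (norm_trace_le hh hφ τ y _) _ _)
    (norm_lagGrad_sub_le hh hr hφ h1 τ y) N
  push_cast at this ⊢
  exact this

end Bounds

/-! ### The mean squared error -/

section Expectation

variable [MeasurableSpace S] [MeasurableSingletonClass S] {Ω : Type*} [MeasurableSpace Ω]
  {μ : Measure Ω} [IsProbabilityMeasure μ] {M : Problem S d} {stat : S → ℝ} {h : Hyper}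
  {B κ ρ w : ℝ} {θ₁ θs : EuclideanSpace ℝ (Fin d)} {X : ℕ → Ω → S}

/-- The weighted squared error is dominated in mean by the inner product with the lagged
semi-gradient. -/
theorem integral_lagGrad_ge (hh : h.Valid B w) (hM : Admissible M stat B κ ρ w) (hκ : 0 ≤ κ)
    (hρ0 : 0 ≤ ρ) (hρ1 : ρ ≤ 1) (hX : IsMarkovChain μ M.P X) (h1 : ‖θ₁‖ ≤ h.R)
    (hs : M.gLam stat h.γ h.lam θs = 0) {τ : ℕ} (hτ : 1 ≤ τ) (n : ℕ) :
    (1 - h.γ) * w * ∫ ω, 1 / √((M.pathRun h θ₁ n fun i => X i ω).v + h.δ)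
          * ‖θs - (M.pathRun h θ₁ n fun i => X i ω).theta‖ ^ 2 ∂μ
        - 2 * h.R * gradBound h B / √h.δ * (κ * ρ ^ τ + h.γ ^ τ)
      ≤ ∫ ω, 1 / √((M.pathRun h θ₁ n fun i => X i ω).v + h.δ)
        * inner ℝ (θs - (M.pathRun h θ₁ n fun i => X i ω).theta)
          (M.lagGrad h θ₁ τ (fun i => X i ω) n) ∂μ := by
  have : Nonempty S := (nonempty_of_isProbabilityMeasure μ).map (X 0)
  have hP := hM.stochastic
  have hφ := hM.feature
  have hr := hM.reward
  have h0 : ∀ s, 0 ≤ stat s := fun s => (hM.ergodic.pos s).le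
  have hθs := hM.norm_limit_le hh hs
  have hB := hM.B_nonneg
  have hR := hh.R_pos
  have hγ0 := hh.γ_pos
  have hg : 0 < 1 - h.γ := by linarith [hh.γ_lt]
  have hsδ : 0 < √h.δ := Real.sqrt_pos.2 hh.δ_pos
  set b : (ℕ → S) → ℝ := fun y => 1 / √((M.pathRun h θ₁ n y).v + h.δ) with hb
  set θ : (ℕ → S) → EuclideanSpace ℝ (Fin d) := fun y => (M.pathRun h θ₁ n y).theta with hθ
  have hbd : DependsOn b (Set.Iic n) := fun x y hxy => by
    simp only [hb, M.dependsOn_pathRun h θ₁ n hxy]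
  have hθd : DependsOn θ (Set.Iic n) := fun x y hxy => by
    simp only [hθ, M.dependsOn_pathRun h θ₁ n hxy]
  have hb0 : ∀ y, 0 < b y := fun y => (adaptiveMomentum_pathRun hh hr hφ h1 y).rate_pos n
  have hb1 : ∀ y, b y ≤ 1 / √h.δ := fun y => (adaptiveMomentum_pathRun hh hr hφ h1 y).rate_le n
  have hθR : ∀ y, ‖θ y‖ ≤ h.R := fun y => norm_pathRun_theta_le hh h1 y n
  have hdist : ∀ y, ‖θs - θ y‖ ≤ 2 * h.R := fun y =>
    (norm_sub_le _ _).trans (by linarith [hθR y])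
  set x := h.γ * h.lam with hx
  have hx0 : 0 ≤ x := hh.decay_nonneg
  have hxγ : x ≤ h.γ := hh.decay_le
  -- One summand of the lagged inner product: the path enters through times `≤ n`, and the three
  -- states are the trace state and the two ends of the transition.
  set T : (ℕ → S) → S → S → S → ℝ := fun y s s' s'' =>
    b y * M.feat (θs - θ y) s * M.tdError h.γ (θ y) s' s'' with hTdef
  have hT : DependsOn T (Set.Iic n) := fun y y' hy => by
    simp only [hTdef, hbd hy, hθd hy]
  set H := 1 / √h.δ * (2 * h.R) * (B + 2 * h.R) with hHdef
  have hH : ∀ y s s' s'', |T y s s' s''| ≤ H := fun y s s' s'' => by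
    rw [hTdef, abs_mul, abs_mul, abs_of_pos (hb0 y)]
    exact mul_le_mul (mul_le_mul (hb1 y) (M.abs_feat_le hφ (hdist y) s) (abs_nonneg _)
      (by positivity)) (abs_tdError_le hh hr hφ (hθR y) s' s'') (abs_nonneg _) (by positivity)
  have hH0 : 0 ≤ H := by positivity
  have hstat : ∀ (j : ℕ) (y : ℕ → S),
      ∑ s, stat s * ((M.P ^ j) *ᵥ fun s' => (M.P *ᵥ T y s s') s') s
        = b y * wdot stat (M.feat (θs - θ y)) ((M.P ^ j) *ᵥ M.resid h.γ (M.feat (θ y))) := by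
    intro j y
    have e1 : ∀ s s', (M.P *ᵥ T y s s') s'
        = b y * M.feat (θs - θ y) s * M.resid h.γ (M.feat (θ y)) s' := fun s s' => by
      have e2 : T y s s' = (b y * M.feat (θs - θ y) s) •
          (M.r s' + h.γ • M.feat (θ y) - M.feat (θ y) s' • (1 : S → ℝ)) := by
        funext s''
        simp [hTdef, Problem.tdError]
      rw [e2, mulVec_smul, mulVec_sub, mulVec_add, mulVec_smul, mulVec_smul,
        one_vecMul_of_mem_rowStochastic hP]
      simp [Problem.resid, Problem.meanReward, mulVec, dotProduct]
    rw [wdot, Finset.mul_sum]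
    refine Finset.sum_congr rfl fun s _ => ?_
    have e3 : (fun s' => (M.P *ᵥ T y s s') s')
        = (b y * M.feat (θs - θ y) s) • M.resid h.γ (M.feat (θ y)) := funext fun s' => e1 s s'
    rw [e3, mulVec_smul, Pi.smul_apply, smul_eq_mul]
    ring
  have hinner : ∀ y : ℕ → S, b y * inner ℝ (θs - θ y) (M.lagGrad h θ₁ τ y n)
      = ∑ j ∈ Finset.range τ, x ^ j
        * T y (y (n + 2 * τ - j)) (y (n + 2 * τ)) (y (n + 2 * τ + 1)) := fun y => by
    change b y * inner ℝ (θs - θ y) (M.tdError h.γ (θ y) (y (n + 2 * τ)) (y (n + 2 * τ + 1))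
      • M.trace x τ y (n + 2 * τ)) = _
    rw [real_inner_smul_right, Problem.trace, inner_sum, Finset.mul_sum, Finset.mul_sum]
    refine Finset.sum_congr rfl fun j _ => ?_
    rw [real_inner_smul_right, real_inner_comm]
    simp only [hTdef, Problem.feat]
    ring
  have hI : ∀ j, Integrable (fun ω => x ^ j * T (fun i => X i ω) (X (n + 2 * τ - j) ω)
      (X (n + 2 * τ) ω) (X (n + 2 * τ + 1) ω)) μ := fun j =>
    integrable_of_dependsOn hX.measurable (n := n + 2 * τ + 1)
      (F := fun y => x ^ j * T y (y (n + 2 * τ - j)) (y (n + 2 * τ)) (y (n + 2 * τ + 1)))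
      fun y y' hy => by
        have e : T y = T y' := hT fun i hi =>
          hy i (Set.mem_Iic.2 (le_trans (Set.mem_Iic.1 hi) (by omega)))
        simp only [e, hy (n + 2 * τ - j) (Set.mem_Iic.2 (by omega)),
          hy (n + 2 * τ) (Set.mem_Iic.2 (by omega)), hy (n + 2 * τ + 1) (Set.mem_Iic.2 le_rfl)]
  have hI2 : ∀ j, Integrable (fun ω => x ^ j * (b (fun i => X i ω)
      * wdot stat (M.feat (θs - θ fun i => X i ω))
        ((M.P ^ j) *ᵥ M.resid h.γ (M.feat (θ fun i => X i ω))))) μ := fun j =>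
    integrable_of_dependsOn hX.measurable (n := n)
      (F := fun y => x ^ j * (b y * wdot stat (M.feat (θs - θ y))
        ((M.P ^ j) *ᵥ M.resid h.γ (M.feat (θ y))))) fun y y' hy => by
        simp only [hbd hy, hθd hy]
  have hI3 : Integrable (fun ω => b (fun i => X i ω) * ‖θs - θ fun i => X i ω‖ ^ 2) μ :=
    integrable_of_dependsOn hX.measurable (n := n)
      (F := fun y => b y * ‖θs - θ y‖ ^ 2) fun y y' hy => by
        simp only [hbd hy, hθd hy]
  -- The trace state lies `2 * τ - j > τ` steps after time `n`, since `j < τ`.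
  have hmix : ∀ j ∈ Finset.range τ, x ^ j * ∫ ω, b (fun i => X i ω)
        * wdot stat (M.feat (θs - θ fun i => X i ω))
          ((M.P ^ j) *ᵥ M.resid h.γ (M.feat (θ fun i => X i ω))) ∂μ
        - x ^ j * (κ * ρ ^ τ * H)
      ≤ x ^ j * ∫ ω, T (fun i => X i ω) (X (n + 2 * τ - j) ω)
        (X (n + 2 * τ) ω) (X (n + 2 * τ + 1) ω) ∂μ := fun j hj => by
    have hj' := Finset.mem_range.1 hj
    have h2 := hX.abs_integral_sub_le hP hM.ergodic (2 * τ - j) j hT hH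
    rw [show n + (2 * τ - j) + j = n + 2 * τ by omega,
      show n + (2 * τ - j) = n + 2 * τ - j by omega] at h2
    simp only [hstat] at h2
    have h3 : κ * ρ ^ (2 * τ - j) * H ≤ κ * ρ ^ τ * H :=
      mul_le_mul_of_nonneg_right (mul_le_mul_of_nonneg_left
        (pow_le_pow_of_le_one hρ0 hρ1 (by omega)) hκ) hH0
    have h4 := (abs_le.1 (h2.trans h3)).1
    rw [← mul_sub]
    exact mul_le_mul_of_nonneg_left (by linarith) (pow_nonneg hx0 j)
  have hdrift : (1 - h.γ) * w * ∫ ω, b (fun i => X i ω) * ‖θs - θ fun i => X i ω‖ ^ 2 ∂μ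
        - 2 * h.R * gradBound h B / √h.δ * h.γ ^ τ
      ≤ ∑ j ∈ Finset.range τ, x ^ j * ∫ ω, b (fun i => X i ω)
        * wdot stat (M.feat (θs - θ fun i => X i ω))
          ((M.P ^ j) *ᵥ M.resid h.γ (M.feat (θ fun i => X i ω))) ∂μ := by
    simp only [← integral_const_mul]
    rw [← integral_finsetSum _ fun j _ => hI2 j]
    have e : ∫ ω, (1 - h.γ) * w * (b (fun i => X i ω) * ‖θs - θ fun i => X i ω‖ ^ 2) ∂μ
          - 2 * h.R * gradBound h B / √h.δ * h.γ ^ τ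
        = ∫ ω, ((1 - h.γ) * w * (b (fun i => X i ω) * ‖θs - θ fun i => X i ω‖ ^ 2)
          - 2 * h.R * gradBound h B / √h.δ * h.γ ^ τ) ∂μ := by
      rw [integral_sub (hI3.const_mul _) (integrable_const _)]
      simp
    rw [e]
    refine integral_mono ((hI3.const_mul _).sub (integrable_const _))
      (integrable_finsetSum _ fun j _ => hI2 j) fun ω => ?_
    dsimp only
    set y : ℕ → S := fun i => X i ω
    have h2 := mul_le_mul_of_nonneg_left (hM.drift_ge hh hs (hθR y) hτ) (hb0 y).le
    have h3 : 2 * h.R * (B + 2 * h.R) * x ^ τ / (1 - x)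
        ≤ 2 * h.R * gradBound h B * h.γ ^ τ := by
      calc _ ≤ 2 * h.R * (B + 2 * h.R) * h.γ ^ τ / (1 - h.γ) := by gcongr
        _ = _ := by rw [gradBound]; ring
    have h4 : b y * (2 * h.R * (B + 2 * h.R) * x ^ τ / (1 - x))
        ≤ 1 / √h.δ * (2 * h.R * gradBound h B * h.γ ^ τ) :=
      mul_le_mul (hb1 y) h3 (div_nonneg (by positivity) (by linarith [hh.γ_lt])) (by positivity)
    have h5 : 1 / √h.δ * (2 * h.R * gradBound h B * h.γ ^ τ)
        = 2 * h.R * gradBound h B / √h.δ * h.γ ^ τ := by ring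
    rw [Finset.mul_sum] at h2
    have h6 : ∀ j ∈ Finset.range τ, b y * (x ^ j * wdot stat (M.feat (θs - θ y))
          ((M.P ^ j) *ᵥ M.resid h.γ (M.feat (θ y))))
        = x ^ j * (b y * wdot stat (M.feat (θs - θ y))
          ((M.P ^ j) *ᵥ M.resid h.γ (M.feat (θ y)))) := fun j _ => by ring
    rw [Finset.sum_congr rfl h6] at h2
    linarith
  have hfin : ∑ j ∈ Finset.range τ, x ^ j * (κ * ρ ^ τ * H)
      ≤ 2 * h.R * gradBound h B / √h.δ * (κ * ρ ^ τ) := by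
    rw [← Finset.sum_mul]
    calc _ ≤ (1 - h.γ)⁻¹ * (κ * ρ ^ τ * H) :=
          mul_le_mul_of_nonneg_right (hh.sum_decay_le τ) (by positivity)
      _ = _ := by rw [hHdef, gradBound]; ring
  have hsum := Finset.sum_le_sum hmix
  rw [Finset.sum_sub_distrib] at hsum
  change (1 - h.γ) * w * ∫ ω, b (fun i => X i ω) * ‖θs - θ fun i => X i ω‖ ^ 2 ∂μ
      - 2 * h.R * gradBound h B / √h.δ * (κ * ρ ^ τ + h.γ ^ τ)
    ≤ ∫ ω, b (fun i => X i ω)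
      * inner ℝ (θs - θ fun i => X i ω) (M.lagGrad h θ₁ τ (fun i => X i ω) n) ∂μ
  simp only [hinner]
  rw [integral_finsetSum _ fun j _ => hI j]
  simp only [integral_const_mul]
  linarith

/-- The accumulated weighted mean squared error is a transient, up to the mixing error. -/
theorem sum_integral_le (hh : h.Valid B w) (hM : Admissible M stat B κ ρ w) (hκ : 0 ≤ κ)
    (hρ0 : 0 ≤ ρ) (hρ1 : ρ ≤ 1) (hX : IsMarkovChain μ M.P X) (h1 : ‖θ₁‖ ≤ h.R)
    (hs : M.gLam stat h.γ h.lam θs = 0) {τ : ℕ} (hτ : 1 ≤ τ) (N : ℕ) :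
    (1 - h.γ) * w / 2 * ∑ n ∈ Finset.range N,
        ∫ ω, 1 / √((M.pathRun h θ₁ n fun i => X i ω).v + h.δ)
          * ‖θs - (M.pathRun h θ₁ n fun i => X i ω).theta‖ ^ 2 ∂μ
      ≤ transientConst h B w * (2 * τ + 1) ^ 2
          * (1 + Real.log (1 + gradBound h B ^ 2 * (N + 2 * τ : ℕ) / h.δ))
        + N * (2 * h.R * gradBound h B / √h.δ * (κ * ρ ^ τ + 2 * h.γ ^ τ)) := by
  have : Nonempty S := (nonempty_of_isProbabilityMeasure μ).map (X 0)
  have hI1 : ∀ n, Integrable (fun ω => 1 / √((M.pathRun h θ₁ n fun i => X i ω).v + h.δ)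
      * inner ℝ (θs - (M.pathRun h θ₁ n fun i => X i ω).theta)
        (M.lagGrad h θ₁ τ (fun i => X i ω) n)) μ := fun n =>
    integrable_of_dependsOn hX.measurable (n := n + 2 * τ + 1)
      (F := fun y => 1 / √((M.pathRun h θ₁ n y).v + h.δ)
        * inner ℝ (θs - (M.pathRun h θ₁ n y).theta) (M.lagGrad h θ₁ τ y n))
      fun y y' hy => by
        have e : M.pathRun h θ₁ n y = M.pathRun h θ₁ n y' := M.dependsOn_pathRun h θ₁ n
          fun i hi => hy i (Set.mem_Iic.2 (le_trans (Set.mem_Iic.1 hi) (by omega)))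
        have e2 : M.trace (h.γ * h.lam) τ y (n + 2 * τ) = M.trace (h.γ * h.lam) τ y' (n + 2 * τ) :=
          Finset.sum_congr rfl fun j _ => by rw [hy _ (Set.mem_Iic.2 (by omega))]
        simp only [Problem.lagGrad, e, e2, hy (n + 2 * τ) (Set.mem_Iic.2 (by omega)),
          hy (n + 2 * τ + 1) (Set.mem_Iic.2 le_rfl)]
  have hI2 : ∀ n, Integrable (fun ω => 1 / √((M.pathRun h θ₁ n fun i => X i ω).v + h.δ)
      * ‖θs - (M.pathRun h θ₁ n fun i => X i ω).theta‖ ^ 2) μ := fun n =>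
    integrable_of_dependsOn hX.measurable (n := n)
      (F := fun y => 1 / √((M.pathRun h θ₁ n y).v + h.δ)
        * ‖θs - (M.pathRun h θ₁ n y).theta‖ ^ 2)
      fun y y' hy => by simp only [M.dependsOn_pathRun h θ₁ n hy]
  have hpath := fun ω => sum_lagGrad_le hh hM.eigen_pos hM.reward hM.feature h1
    (hM.norm_limit_le hh hs) τ N (fun i => X i ω)
  -- The pathwise upper bound is integrated, to be set against the lower bound from the drift; half
  -- of the weighted error cancels.
  have hint := integral_mono (μ := μ) (integrable_finsetSum _ fun n _ => hI1 n)
    ((((integrable_finsetSum _ fun n _ => hI2 n).const_mul _).add (integrable_const _)).add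
      (integrable_const _)) hpath
  rw [integral_finsetSum _ fun n _ => hI1 n, integral_add' (((integrable_finsetSum _ fun n _ =>
    hI2 n).const_mul _).add (integrable_const _)) (integrable_const _),
    integral_add' ((integrable_finsetSum _ fun n _ => hI2 n).const_mul _) (integrable_const _),
    integral_const_mul, integral_finsetSum _ fun n _ => hI2 n] at hint
  simp only [integral_const, probReal_univ, one_smul] at hint
  have hlow := Finset.sum_le_sum fun n (_ : n ∈ Finset.range N) =>
    integral_lagGrad_ge hh hM hκ hρ0 hρ1 hX h1 hs hτ n
  rw [Finset.sum_sub_distrib, ← Finset.mul_sum, Finset.sum_const, Finset.card_range,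
    nsmul_eq_mul] at hlow
  -- One `γ ^ τ` comes from truncating the mean direction, the other from truncating the trace along
  -- the path.
  have e : (N : ℝ) * (2 * h.R * gradBound h B / √h.δ * (κ * ρ ^ τ + 2 * h.γ ^ τ))
      = N * (2 * h.R * gradBound h B / √h.δ * (κ * ρ ^ τ + h.γ ^ τ))
        + N * (2 * h.R * (gradBound h B * h.γ ^ τ) / √h.δ) := by ring
  rw [e]
  linarith

end Expectation

/-! ### Complexity -/

theorem sparseRate_pos {ν ε ρ : ℝ} (hε0 : 0 < ε) (hε1 : ε < 1) (hρ0 : 0 < ρ) (hρ1 : ρ < 1) :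
    0 < sparseRate ν ε ρ := by
  have h1 : 0 < Real.log (1 / ε) := Real.log_pos (by rw [lt_div_iff₀ hε0]; linarith)
  have h2 : 0 < Real.log (1 / ρ) := Real.log_pos (by rw [lt_div_iff₀ hρ0]; linarith)
  unfold sparseRate
  positivity

/-- With `t = log (1 / ε) / log (1 / ρ)` this says `ε * b ^ (1 - ν / 2) = t ^ 2`: the rate `b` is
just large enough to pay for the factor `t ^ 2` in `τ ^ 2`. -/
theorem sparseRate_rpow {ν ε ρ : ℝ} (hν : ν ≤ 1) (hε0 : 0 < ε) (hε1 : ε < 1) (hρ0 : 0 < ρ)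
    (hρ1 : ρ < 1) :
    sparseRate ν ε ρ ^ (1 - ν / 2) = (Real.log (1 / ε) / Real.log (1 / ρ)) ^ 2 / ε := by
  have h1 : 0 < Real.log (1 / ε) := Real.log_pos (by rw [lt_div_iff₀ hε0]; linarith)
  have h2 : 0 < Real.log (1 / ρ) := Real.log_pos (by rw [lt_div_iff₀ hρ0]; linarith)
  have hq : 1 - ν / 2 ≠ 0 := by linarith
  unfold sparseRate
  rw [Real.div_rpow (by positivity) (by positivity), Real.mul_rpow (by positivity) (by positivity),
    ← Real.rpow_mul h1.le, ← Real.rpow_mul h2.le, ← Real.rpow_mul hε0.le, div_mul_cancel₀ _ hq,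
    div_mul_cancel₀ _ hq, Real.rpow_one, Real.rpow_two, Real.rpow_two]
  field_simp

theorem sparseRate_one (ε ρ : ℝ) : sparseRate 1 ε ρ = generalRate ε ρ := by
  have h1 : (2 : ℝ) / (1 - 1 / 2) = (4 : ℕ) := by norm_num
  have h2 : (1 : ℝ) / (1 - 1 / 2) = (2 : ℕ) := by norm_num
  rw [sparseRate, generalRate, h1, h2, Real.rpow_natCast, Real.rpow_natCast, Real.rpow_natCast]

theorem pow_ceil_le_inv {ρ : ℝ} (hρ0 : 0 < ρ) (hρ1 : ρ < 1) {N τ : ℕ} (hN : 1 ≤ N)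
    (hτ : Real.log N * (1 / Real.log (1 / ρ)) ≤ τ) : (N : ℝ) * ρ ^ τ ≤ 1 := by
  have h2 : 0 < Real.log (1 / ρ) := Real.log_pos (by rw [lt_div_iff₀ hρ0]; linarith)
  have hN' : (0 : ℝ) < N := by exact_mod_cast hN
  rw [mul_one_div, div_le_iff₀ h2, one_div, Real.log_inv] at hτ
  rw [← Real.log_nonpos_iff (by positivity), Real.log_mul hN'.ne' (by positivity), Real.log_pow]
  linarith

/-- The number of iterations for which the transient and the mixing error are small. -/
theorem exists_iterations {a A D κ G δ c γ ν : ℝ} (ha : 0 < a) (hA : 0 ≤ A) (hD : 0 ≤ D)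
    (hκ : 0 ≤ κ) (hG : 0 ≤ G) (hδ : 0 < δ) (hc : 0 < c) (hγ0 : 0 < γ) (hγ1 : γ < 1)
    (hν0 : 0 ≤ ν) (hν1 : ν ≤ 1) :
    ∃ ε₁ > (0 : ℝ), ∀ ρ ε : ℝ, 0 < ρ → ρ < 1 → 0 < ε → ε ≤ ε₁ → ε ≤ ρ → ∃ N τ : ℕ,
      1 ≤ N ∧ 1 ≤ τ ∧ (N : ℝ) ≤ 2 * sparseRate ν ε ρ * Real.log (sparseRate ν ε ρ) ^ 8 ∧
      A * (2 * τ + 1) ^ 2 * (1 + Real.log (1 + G * (N + 2 * τ : ℕ) / δ))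
        + N * (D * (κ * ρ ^ τ + 2 * γ ^ τ)) < a * (ε * (N * (1 / √(c * (N : ℝ) ^ ν + δ)))) := by
  have hlγ : 0 < Real.log (1 / γ) := Real.log_pos (by rw [lt_div_iff₀ hγ0]; linarith)
  set g := 1 + 1 / Real.log (1 / γ) with hg
  have hg1 : 1 ≤ g := by rw [hg]; linarith [one_div_pos.2 hlγ]
  set k := 1 + G * (2 + 22 * g) / δ with hk
  have hk1 : 1 ≤ k := by
    have : 0 ≤ G * (2 + 22 * g) / δ := by positivity
    linarith
  have hlk : 0 ≤ Real.log k := Real.log_nonneg hk1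
  set C₀ := A * (33 * g) ^ 2 * (10 + Real.log k) + D * (κ + 2) with hC₀
  have hC₀0 : 0 ≤ C₀ := by positivity
  have hcδ : 0 < √(c + δ) := Real.sqrt_pos.2 (by linarith)
  set C₁ := a / √(c + δ) with hC₁
  have hC₁0 : 0 < C₁ := by positivity
  -- This makes `log (1 / ε)`, and hence `log b`, exceed both `1` and the ratio of the constants.
  refine ⟨Real.exp (-(1 + C₀ / C₁)), Real.exp_pos _, fun ρ ε hρ0 hρ1 hε0 hε1 hερ => ?_⟩
  have hε_lt : ε < 1 := hερ.trans_lt hρ1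
  set b := sparseRate ν ε ρ with hb
  have hb0 : 0 < b := sparseRate_pos hε0 hε_lt hρ0 hρ1
  have hq := sparseRate_rpow hν1 hε0 hε_lt hρ0 hρ1
  rw [← hb] at hq
  have hlε : 1 + C₀ / C₁ ≤ Real.log (1 / ε) := by
    rw [one_div, Real.log_inv]
    have := Real.log_le_log hε0 hε1
    rw [Real.log_exp] at this
    linarith
  have hC01 : 0 ≤ C₀ / C₁ := div_nonneg hC₀0 hC₁0.le
  have hlρ : 0 < Real.log (1 / ρ) := Real.log_pos (by rw [lt_div_iff₀ hρ0]; linarith)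
  have hlερ : Real.log (1 / ρ) ≤ Real.log (1 / ε) :=
    Real.log_le_log (by positivity) (one_div_le_one_div_of_le hε0 hερ)
  set t := Real.log (1 / ε) / Real.log (1 / ρ) with ht
  -- The assumption `ε ≤ ρ` enters here; with `log (1 / ε) ≥ 1` it lets `t` absorb both mixing
  -- times, so no constant depends on `ρ`.
  have ht1 : 1 ≤ t := (one_le_div hlρ).2 hlερ
  have htρ : 1 / Real.log (1 / ρ) ≤ t := div_le_div_of_nonneg_right (by linarith) hlρ.le
  have hq0 : 1 / 2 ≤ 1 - ν / 2 := by linarith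
  have hq1 : 1 - ν / 2 ≤ 1 := by linarith
  have hεb : ε * b ^ (1 - ν / 2) = t ^ 2 := by rw [hq]; field_simp
  have hbq : 1 / ε ≤ b ^ (1 - ν / 2) := by
    rw [hq]
    exact div_le_div_of_nonneg_right (one_le_pow₀ ht1) hε0.le
  have hε_inv : 1 < 1 / ε := by rw [lt_div_iff₀ hε0]; linarith
  have hb1 : 1 ≤ b := by
    by_contra hcon
    have := Real.rpow_le_one hb0.le (not_le.1 hcon).le (z := 1 - ν / 2) (by linarith)
    linarith
  have hbqb : b ^ (1 - ν / 2) ≤ b := by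
    simpa using Real.rpow_le_rpow_of_exponent_le hb1 hq1
  set ℓ := Real.log b with hℓ
  have hℓε : Real.log (1 / ε) ≤ ℓ := Real.log_le_log (by positivity) (hbq.trans hbqb)
  have hℓ1 : 1 ≤ ℓ := by linarith
  have hℓC : C₀ < C₁ * ℓ := by
    have : C₀ / C₁ < ℓ := by linarith
    rwa [div_lt_iff₀ hC₁0, mul_comm] at this
  have hℓb : ℓ ≤ b := (Real.log_le_sub_one_of_pos hb0).trans (by linarith)
  have htb : t ≤ b := by
    have h1 : t ^ 2 ≤ b := by
      rw [← hεb]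
      exact (mul_le_of_le_one_left (by positivity) hε_lt.le).trans hbqb
    exact (le_self_pow₀ ht1 two_ne_zero).trans h1
  have hℓ8 : 1 ≤ ℓ ^ 8 := one_le_pow₀ hℓ1
  have hbℓ : 1 ≤ b * ℓ ^ 8 := one_le_mul_of_one_le_of_one_le hb1 hℓ8
  -- The lag and the logarithm cost `ℓ ^ 3`. As `1 - ν / 2 ≥ 1 / 2`, the factor `ℓ ^ 8` yields at
  -- least `ℓ ^ 4` on the other side, and the spare `ℓ` beats the constants.
  set N := ⌈b * ℓ ^ 8⌉₊ with hN
  have hNlo : b * ℓ ^ 8 ≤ N := Nat.le_ceil _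
  have hN1' : (1 : ℝ) ≤ N := hbℓ.trans hNlo
  have hN1 : 1 ≤ N := by exact_mod_cast hN1'
  have hNhi : (N : ℝ) ≤ 2 * (b * ℓ ^ 8) :=
    (Nat.ceil_lt_add_one (by linarith)).le.trans (by linarith)
  have hNb : (N : ℝ) ≤ 2 * b ^ 9 := by
    have h1 : ℓ ^ 8 ≤ b ^ 8 := pow_le_pow_left₀ (by linarith) hℓb 8
    have h2 := mul_le_mul_of_nonneg_left h1 hb0.le
    rw [← pow_succ', show 8 + 1 = 9 from rfl] at h2
    linarith
  have hLN : Real.log N ≤ 10 * ℓ := by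
    have h1 := Real.log_le_log (by linarith) hNb
    rw [Real.log_mul two_ne_zero (by positivity), Real.log_pow] at h1
    have := Real.log_two_lt_d9
    push_cast at h1
    linarith
  have hLN1 : 1 ≤ Real.log N := hℓ1.trans (Real.log_le_log hb0
    ((le_mul_of_one_le_right hb0.le hℓ8).trans hNlo))
  have hρ' : 0 < 1 / Real.log (1 / ρ) := one_div_pos.2 hlρ
  have hγ' : 0 < 1 / Real.log (1 / γ) := one_div_pos.2 hlγ
  -- Long enough that `N * ρ ^ τ` and `N * γ ^ τ` are both at most `1`.
  set τ := ⌈Real.log N * (1 / Real.log (1 / ρ) + 1 / Real.log (1 / γ))⌉₊ with hτ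
  have hτ0 : 0 < Real.log N * (1 / Real.log (1 / ρ) + 1 / Real.log (1 / γ)) :=
    mul_pos (by linarith) (by linarith)
  have hτ1 : 1 ≤ τ := Nat.one_le_iff_ne_zero.2 (Nat.ceil_pos.2 hτ0).ne'
  have hτlo : Real.log N * (1 / Real.log (1 / ρ) + 1 / Real.log (1 / γ)) ≤ τ := Nat.le_ceil _
  have hτhi : (τ : ℝ) ≤ 11 * g * (ℓ * t) := by
    have h1 := (Nat.ceil_lt_add_one hτ0.le).le
    have h2 : 1 / Real.log (1 / ρ) + 1 / Real.log (1 / γ) ≤ g * t := by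
      have := le_mul_of_one_le_right hγ'.le ht1
      rw [hg, add_mul, one_mul]
      linarith
    have h3 : Real.log N * (1 / Real.log (1 / ρ) + 1 / Real.log (1 / γ)) ≤ 10 * ℓ * (g * t) :=
      mul_le_mul hLN h2 (by linarith) (by linarith)
    have h4 : 1 ≤ g * (ℓ * t) :=
      one_le_mul_of_one_le_of_one_le hg1 (one_le_mul_of_one_le_of_one_le hℓ1 ht1)
    linarith
  have hNρ : (N : ℝ) * ρ ^ τ ≤ 1 := pow_ceil_le_inv hρ0 hρ1 hN1 (le_trans
    (mul_le_mul_of_nonneg_left (by linarith) (by linarith)) hτlo)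
  have hNγ : (N : ℝ) * γ ^ τ ≤ 1 := pow_ceil_le_inv hγ0 hγ1 hN1 (le_trans
    (mul_le_mul_of_nonneg_left (by linarith) (by linarith)) hτlo)
  refine ⟨N, τ, hN1, hτ1, by linarith, ?_⟩
  have hmix : N * (D * (κ * ρ ^ τ + 2 * γ ^ τ)) ≤ D * (κ + 2) := by
    calc _ = D * (κ * (N * ρ ^ τ) + 2 * (N * γ ^ τ)) := by ring
      _ ≤ D * (κ * 1 + 2 * 1) := by gcongr
      _ = _ := by ring
  have hlog : 1 + Real.log (1 + G * (N + 2 * τ : ℕ) / δ) ≤ (10 + Real.log k) * ℓ := by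
    have h1 : ((N + 2 * τ : ℕ) : ℝ) ≤ (2 + 22 * g) * b ^ 9 := by
      push_cast
      have h2 : ℓ * t ≤ b ^ 9 := by
        calc ℓ * t ≤ b * b := mul_le_mul hℓb htb (by linarith) hb0.le
          _ = b ^ 2 := (sq b).symm
          _ ≤ b ^ 9 := pow_le_pow_right₀ hb1 (by norm_num)
      have h3 := mul_le_mul_of_nonneg_left h2 (show 0 ≤ 11 * g by linarith)
      linarith
    have h2 : 1 + G * (N + 2 * τ : ℕ) / δ ≤ k * b ^ 9 := by
      have h3 : G * (N + 2 * τ : ℕ) / δ ≤ G * ((2 + 22 * g) * b ^ 9) / δ := by gcongr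
      have h4 : 1 ≤ b ^ 9 := one_le_pow₀ hb1
      calc _ ≤ b ^ 9 + G * ((2 + 22 * g) * b ^ 9) / δ := by linarith
        _ = _ := by rw [hk]; ring
    have h3 := Real.log_le_log (by positivity) h2
    rw [Real.log_mul (by positivity) (by positivity), Real.log_pow] at h3
    have h4 := le_mul_of_one_le_right hlk hℓ1
    push_cast at h3 ⊢
    linarith
  have hτ2 : (2 * (τ : ℝ) + 1) ^ 2 ≤ (33 * g) ^ 2 * (ℓ * t) ^ 2 := by
    rw [← mul_pow]
    have : (1 : ℝ) ≤ τ := by exact_mod_cast hτ1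
    exact pow_le_pow_left₀ (by positivity) (by linarith) 2
  have hlog0 : 0 ≤ 1 + Real.log (1 + G * (N + 2 * τ : ℕ) / δ) := by
    have : 0 ≤ G * (N + 2 * τ : ℕ) / δ := by positivity
    linarith [Real.log_nonneg (show 1 ≤ 1 + G * (N + 2 * τ : ℕ) / δ by linarith)]
  have hleft : A * (2 * τ + 1) ^ 2 * (1 + Real.log (1 + G * (N + 2 * τ : ℕ) / δ))
        + N * (D * (κ * ρ ^ τ + 2 * γ ^ τ)) ≤ C₀ * (ℓ ^ 3 * t ^ 2) := by
    have h1 : A * (2 * τ + 1) ^ 2 * (1 + Real.log (1 + G * (N + 2 * τ : ℕ) / δ))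
        ≤ A * ((33 * g) ^ 2 * (ℓ * t) ^ 2) * ((10 + Real.log k) * ℓ) :=
      mul_le_mul (mul_le_mul_of_nonneg_left hτ2 hA) hlog hlog0 (by positivity)
    have h2 : 1 ≤ ℓ ^ 3 * t ^ 2 :=
      one_le_mul_of_one_le_of_one_le (one_le_pow₀ hℓ1) (one_le_pow₀ ht1)
    have h3 : D * (κ + 2) ≤ D * (κ + 2) * (ℓ ^ 3 * t ^ 2) :=
      le_mul_of_one_le_right (by positivity) h2
    have h4 : C₀ * (ℓ ^ 3 * t ^ 2) = A * ((33 * g) ^ 2 * (ℓ * t) ^ 2) * ((10 + Real.log k) * ℓ)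
        + D * (κ + 2) * (ℓ ^ 3 * t ^ 2) := by rw [hC₀]; ring
    linarith
  have hright : C₁ * (ℓ ^ 4 * t ^ 2) ≤ a * (ε * (N * (1 / √(c * (N : ℝ) ^ ν + δ)))) := by
    have hN0 : (0 : ℝ) < N := by linarith
    have h1 : √(c * (N : ℝ) ^ ν + δ) ≤ √(c + δ) * (N : ℝ) ^ (ν / 2) := by
      rw [Real.sqrt_le_left (by positivity), mul_pow, Real.sq_sqrt (by linarith),
        ← Real.rpow_natCast ((N : ℝ) ^ (ν / 2)), ← Real.rpow_mul hN0.le, Nat.cast_ofNat,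
        div_mul_cancel₀ _ two_ne_zero]
      have := le_mul_of_one_le_right hδ.le (Real.one_le_rpow hN1' hν0)
      linarith
    have h2 : (N : ℝ) ^ (1 - ν / 2) / √(c + δ) ≤ N * (1 / √(c * (N : ℝ) ^ ν + δ)) := by
      rw [Real.rpow_sub hN0, Real.rpow_one, div_div, mul_one_div]
      refine div_le_div_of_nonneg_left hN0.le (by positivity) ?_
      exact h1.trans_eq (mul_comm _ _)
    have h3 : b ^ (1 - ν / 2) * ℓ ^ 4 ≤ (N : ℝ) ^ (1 - ν / 2) := by
      have h4 : (b * ℓ ^ 8) ^ (1 - ν / 2) ≤ (N : ℝ) ^ (1 - ν / 2) :=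
        Real.rpow_le_rpow (by positivity) hNlo (by linarith)
      refine le_trans ?_ h4
      rw [Real.mul_rpow hb0.le (by positivity)]
      refine mul_le_mul_of_nonneg_left ?_ (by positivity)
      have h5 : ℓ ^ 4 = (ℓ ^ 8) ^ (1 / 2 : ℝ) := by
        rw [← Real.sqrt_eq_rpow, show ℓ ^ 8 = (ℓ ^ 4) ^ 2 by ring, Real.sqrt_sq (by positivity)]
      rw [h5]
      exact Real.rpow_le_rpow_of_exponent_le hℓ8 hq0
    calc C₁ * (ℓ ^ 4 * t ^ 2) = a * (ε * (b ^ (1 - ν / 2) * ℓ ^ 4 / √(c + δ))) := by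
          rw [hC₁, ← hεb]; ring
      _ ≤ a * (ε * ((N : ℝ) ^ (1 - ν / 2) / √(c + δ))) := by gcongr
      _ ≤ _ := by gcongr
  refine hleft.trans_lt (lt_of_lt_of_le ?_ hright)
  have h1 : 0 < ℓ ^ 3 * t ^ 2 := by positivity
  calc C₀ * (ℓ ^ 3 * t ^ 2) < C₁ * ℓ * (ℓ ^ 3 * t ^ 2) := mul_lt_mul_of_pos_right hℓC h1
    _ = _ := by ring

section Rate

variable [MeasurableSpace S] [MeasurableSingletonClass S] {Ω : Type*} [MeasurableSpace Ω]
  {μ : Measure Ω} [IsProbabilityMeasure μ] {M : Problem S d} {stat : S → ℝ} {h : Hyper}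
  {B κ ρ w : ℝ} {θ₁ θs : EuclideanSpace ℝ (Fin d)} {s : ℕ → Ω → S}

/-- If all errors exceeded `ε`, the lower bound on the weights from the growth of `v` would
contradict `sum_integral_le`. -/
theorem IsRun.exists_err_le (hh : h.Valid B w) (hrun : IsRun μ M stat h B κ ρ w s θ₁ θs)
    (hκ : 0 ≤ κ) (hρ0 : 0 ≤ ρ) (hρ1 : ρ ≤ 1) {c ν ε : ℝ} (hc : 0 ≤ c) (hν : 0 ≤ ν)
    (hv : ∀ᵐ ω ∂μ, ∀ k : ℕ, 1 ≤ k → M.v h θ₁ (fun i => s i ω) k ≤ c * (k : ℝ) ^ ν)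
    {N τ : ℕ} (hτ : 1 ≤ τ)
    (hN : transientConst h B w * (2 * τ + 1) ^ 2
          * (1 + Real.log (1 + gradBound h B ^ 2 * (N + 2 * τ : ℕ) / h.δ))
        + N * (2 * h.R * gradBound h B / √h.δ * (κ * ρ ^ τ + 2 * h.γ ^ τ))
      < (1 - h.γ) * w / 2 * (ε * (N * (1 / √(c * (N : ℝ) ^ ν + h.δ))))) :
    ∃ k, 1 ≤ k ∧ k ≤ N ∧ M.err μ h s θ₁ θs k ≤ ε := by
  by_contra! hcon
  have hX := hrun.chain
  have hM := hrun.admissible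
  have hsum := sum_integral_le hh hM hκ hρ0 hρ1 hX hrun.init hrun.limit hτ N
  set X : ℕ → Ω → S := fun k => s (k + 1)
  have hg : 0 < (1 - h.γ) * w / 2 := by
    have := mul_pos (sub_pos.2 hh.γ_lt) hM.eigen_pos
    linarith
  have hδ := hh.δ_pos
  refine absurd (hsum.trans_lt hN) (not_lt.2 (mul_le_mul_of_nonneg_left ?_ hg.le))
  have hterm : ∀ n ∈ Finset.range N, ε * (1 / √(c * (N : ℝ) ^ ν + h.δ))
      ≤ ∫ ω, 1 / √((M.pathRun h θ₁ n fun i => X i ω).v + h.δ)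
          * ‖θs - (M.pathRun h θ₁ n fun i => X i ω).theta‖ ^ 2 ∂μ := fun n hn => by
    have hn' := Finset.mem_range.1 hn
    have herr := hcon (n + 1) (by omega) (by omega)
    have e1 : M.err μ h s θ₁ θs (n + 1)
        = ∫ ω, ‖θs - (M.pathRun h θ₁ n fun i => X i ω).theta‖ ^ 2 ∂μ :=
      integral_congr_ae (Eventually.of_forall fun ω => by
        simp only [Problem.theta, Nat.add_sub_cancel, M.run_eq_pathRun, X])
    rw [e1] at herr
    have hb0 : 0 ≤ 1 / √(c * (N : ℝ) ^ ν + h.δ) := by positivity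
    refine (mul_le_mul_of_nonneg_right herr.le hb0).trans ?_
    rw [mul_comm, ← integral_const_mul]
    refine integral_mono_ae ?_ ?_ ?_
    · exact integrable_of_dependsOn hX.measurable (n := n)
        (F := fun y => 1 / √(c * (N : ℝ) ^ ν + h.δ)
          * ‖θs - (M.pathRun h θ₁ n y).theta‖ ^ 2)
        fun y y' hy => by simp only [M.dependsOn_pathRun h θ₁ n hy]
    · exact integrable_of_dependsOn hX.measurable (n := n)
        (F := fun y => 1 / √((M.pathRun h θ₁ n y).v + h.δ)
          * ‖θs - (M.pathRun h θ₁ n y).theta‖ ^ 2)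
        fun y y' hy => by simp only [M.dependsOn_pathRun h θ₁ n hy]
    · filter_upwards [hv] with ω hω
      refine mul_le_mul_of_nonneg_right ?_ (sq_nonneg _)
      have hv0 := (adaptiveMomentum_pathRun hh hM.reward hM.feature hrun.init
        fun i => X i ω).v_nonneg n
      have hvn : (M.pathRun h θ₁ n fun i => X i ω).v ≤ c * (N : ℝ) ^ ν := by
        -- The growth condition starts at `k = 1`; initially the accumulator is `0`.
        rcases Nat.eq_zero_or_pos n with rfl | hpos
        · change (0 : ℝ) ≤ _
          positivity
        · have h1 := hω n hpos
          rw [Problem.v, M.run_eq_pathRun] at h1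
          refine h1.trans (mul_le_mul_of_nonneg_left ?_ hc)
          exact Real.rpow_le_rpow (Nat.cast_nonneg n) (by exact_mod_cast hn'.le) hν
      have : 0 < (M.pathRun h θ₁ n fun i => X i ω).v + h.δ := by linarith
      exact one_div_le_one_div_of_le (Real.sqrt_pos.2 this) (Real.sqrt_le_sqrt (by linarith))
  have := Finset.sum_le_sum hterm
  rw [Finset.sum_const, Finset.card_range, nsmul_eq_mul] at this
  linarith

theorem reachesWithin_of_exists {e : ℕ → ℝ} {ε C : ℝ} {N : ℕ} (hN : 1 ≤ N) (hC : (N : ℝ) ≤ C)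
    (h : ∃ k, 1 ≤ k ∧ k ≤ N ∧ e k ≤ ε) : ReachesWithin e ε C := by
  obtain ⟨k, h1, h2, h3⟩ := h
  exact ⟨N, hN, hC, (ciInf_le (f := fun k : Set.Icc 1 N => e k) (Set.finite_range _).bddBelow
    ⟨k, h1, h2⟩).trans h3⟩

end Rate

theorem exists_sparse_complexity.{u, v} (h : Hyper) (B κ w : ℝ) (hκ : 0 < κ) (hh : h.Valid B w)
    (c ν : ℝ) (hc : 0 < c) (hν0 : 0 < ν) (hν1 : ν ≤ 1) :
    ∃ ε₁ > (0 : ℝ),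
      ∀ (S : Type u) [Fintype S] [DecidableEq S] [MeasurableSpace S] [MeasurableSingletonClass S]
        (d : ℕ) (M : Problem S d) (stat : S → ℝ) (ρ : ℝ)
        (Ω : Type v) [MeasurableSpace Ω] (μ : Measure Ω) [IsProbabilityMeasure μ]
        (s : ℕ → Ω → S) (θ₁ θs : EuclideanSpace ℝ (Fin d)),
        0 < ρ → ρ < 1 → IsRun μ M stat h B κ ρ w s θ₁ θs →
        (∀ᵐ ω ∂μ, ∀ k : ℕ, 1 ≤ k → M.v h θ₁ (fun i => s i ω) k ≤ c * (k : ℝ) ^ ν) →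
        ∀ ε : ℝ, 0 < ε → ε ≤ ε₁ → ε ≤ ρ →
          ReachesWithin (M.err μ h s θ₁ θs) ε
            (2 * sparseRate ν ε ρ * Real.log (sparseRate ν ε ρ) ^ 8) := by
  -- The threshold is fixed before any problem is given. If `w` or `B` has the wrong sign, no run
  -- exists and any threshold serves.
  by_cases hwB : 0 < w ∧ 0 ≤ B
  · obtain ⟨hw, hB⟩ := hwB
    have hg : 0 < 1 - h.γ := by linarith [hh.γ_lt]
    have hR := hh.R_pos
    have hη := hh.η_pos
    have hδ := hh.δ_pos
    have hβ : 0 < 1 - h.β := by linarith [hh.β_lt]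
    have hG : 0 ≤ gradBound h B := div_nonneg (by linarith) hg.le
    obtain ⟨ε₁, hε₁, H⟩ := exists_iterations (a := (1 - h.γ) * w / 2) (A := transientConst h B w)
      (D := 2 * h.R * gradBound h B / √h.δ) (κ := κ) (G := gradBound h B ^ 2) (δ := h.δ) (c := c)
      (γ := h.γ) (ν := ν) (by positivity)
      (by unfold transientConst lagConst; positivity) (by positivity) hκ.le (by positivity) hδ hc
      hh.γ_pos hh.γ_lt hν0.le hν1
    refine ⟨ε₁, hε₁, ?_⟩
    intro S _ _ _ _ d M stat ρ Ω _ μ _ s θ₁ θs hρ0 hρ1 hrun hv ε hε0 hε1 hερ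
    obtain ⟨N, τ, hN1, hτ1, hN, hlt⟩ := H ρ ε hρ0 hρ1 hε0 hε1 hερ
    exact reachesWithin_of_exists hN1 hN
      (hrun.exists_err_le hh hκ.le hρ0.le hρ1.le hc.le hν0.le hv hτ1 hlt)
  · refine ⟨1, one_pos, ?_⟩
    intro S _ _ _ _ d M stat ρ Ω _ μ _ s θ₁ θs _ _ hrun
    have : Nonempty S := (nonempty_of_isProbabilityMeasure μ).map (s 0)
    exact absurd ⟨hrun.admissible.eigen_pos, hrun.admissible.B_nonneg⟩ hwB

end AdaTD

end

theorem proposition1 (h : AdaTD.Hyper) (B κ w : ℝ) (hκ : 0 < κ) (hh : h.Valid B w) :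
    (∃ C > (0 : ℝ), ∃ p : ℕ, ∃ ε₁ > (0 : ℝ),
      ∀ (S : Type*) [Fintype S] [DecidableEq S] [MeasurableSpace S] [MeasurableSingletonClass S]
        (d : ℕ) (M : AdaTD.Problem S d) (stat : S → ℝ) (ρ : ℝ)
        (Ω : Type*) [MeasurableSpace Ω] (μ : Measure Ω) [IsProbabilityMeasure μ]
        (s : ℕ → Ω → S) (θ₁ θs : EuclideanSpace ℝ (Fin d)),
        0 < ρ → ρ < 1 → AdaTD.IsRun μ M stat h B κ ρ w s θ₁ θs →
        ∀ ε : ℝ, 0 < ε → ε ≤ ε₁ → ε ≤ ρ →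
          AdaTD.ReachesWithin (M.err μ h s θ₁ θs) ε
            (C * AdaTD.generalRate ε ρ * Real.log (AdaTD.generalRate ε ρ) ^ p)) ∧
    (∀ c ν : ℝ, 0 < c → 0 < ν → ν ≤ 1 → ∃ C > (0 : ℝ), ∃ p : ℕ, ∃ ε₁ > (0 : ℝ),
      ∀ (S : Type*) [Fintype S] [DecidableEq S] [MeasurableSpace S] [MeasurableSingletonClass S]
        (d : ℕ) (M : AdaTD.Problem S d) (stat : S → ℝ) (ρ : ℝ)
        (Ω : Type*) [MeasurableSpace Ω] (μ : Measure Ω) [IsProbabilityMeasure μ]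
        (s : ℕ → Ω → S) (θ₁ θs : EuclideanSpace ℝ (Fin d)),
        0 < ρ → ρ < 1 → AdaTD.IsRun μ M stat h B κ ρ w s θ₁ θs →
        (∀ᵐ ω ∂μ, ∀ k : ℕ, 1 ≤ k → M.v h θ₁ (fun i => s i ω) k ≤ c * (k : ℝ) ^ ν) →
        ∀ ε : ℝ, 0 < ε → ε ≤ ε₁ → ε ≤ ρ →
          AdaTD.ReachesWithin (M.err μ h s θ₁ θs) ε
            (C * AdaTD.sparseRate ν ε ρ * Real.log (AdaTD.sparseRate ν ε ρ) ^ p)) := by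
  constructor
  -- Bounded gradients give linear growth of `v`, so `ν = 1`; the `+ 1` makes the constant `c`
  -- positive without any sign condition on `B`.
  · obtain ⟨ε₁, hε₁, H⟩ := AdaTD.exists_sparse_complexity h B κ w hκ hh
      (AdaTD.gradBound h B ^ 2 + 1) 1 (by positivity) one_pos le_rfl
    refine ⟨2, two_pos, 8, ε₁, hε₁, ?_⟩
    intro S _ _ _ _ d M stat ρ Ω _ μ _ s θ₁ θs hρ0 hρ1 hrun ε hε0 hε1 hερ
    have hM := hrun.admissible
    rw [← AdaTD.sparseRate_one]
    refine H S d M stat ρ Ω μ s θ₁ θs hρ0 hρ1 hrun (Filter.Eventually.of_forall fun ω k _ => ?_)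
      ε hε0 hε1 hερ
    have h1 := (AdaTD.adaptiveMomentum_pathRun hh hM.reward hM.feature hrun.init
      fun i => s (i + 1) ω).v_le k
    rw [AdaTD.Problem.v, M.run_eq_pathRun, Real.rpow_one]
    exact h1.trans (mul_le_mul_of_nonneg_right (by linarith) (Nat.cast_nonneg k))
  · intro c ν hc hν0 hν1
    obtain ⟨ε₁, hε₁, H⟩ := AdaTD.exists_sparse_complexity h B κ w hκ hh c ν hc hν0 hν1
    exact ⟨2, two_pos, 8, ε₁, hε₁, H⟩
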